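/- **Setting.** Let $\Xi$ be a Polish space with its Borel $\sigma$-algebra, $\mathcal P_\Xi$ the set of probability measures on $\Xi$ (with the Borel $\sigma$-algebra of weak convergence), $\Theta$ a set, and $h:\Theta\times\Xi\to[0,K]$, $K<\infty$, a loss that is measurable in its second argument. For $p\in\mathcal P_\Xi$ put $\mathcal R_p(\theta)=\int h(\theta,\xi)\,p(\mathrm d\xi)$. *Data.* There are $S$ groups. For $s=1,\dots,S$ and $j\ge 1$ the observations $\xi_{sj}$ are independent random elements of $\Xi$ on a probability space, $\xi_{sj}\sim p_s^\star$ with $p^\star_s$ diffuse (without atoms). For group sizes $N_1,\dots,N_S\ge 1$ with sum $N$, let $\boldsymbol\xi_s=(\xi_{s1},\dots,\xi_{sN_s})$, let $p_{\boldsymbol\xi_s}$ be its empirical distribution, let $\boldsymbol\xi^N=(\boldsymbol\xi_1,\dots,\boldsymbol\xi_S)$, and let $p_{\boldsymbol\xi^N}$ be the pooled empirical distribution. *Model.* $\mathrm{DP}(\alpha,P)$ is the law of a random probability measure $p$ with $(p(A_1),\dots,p(A_k))\sim\mathrm{Dirichlet}(\alpha P(A_1),\dots,\alpha P(A_k))$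 for every finite measurable partition $\{A_1,\dots,A_k\}$ of $\Xi$. Let $H$ be a diffuse probability measure on $\Xi$ and $\alpha_0,\alpha_1,\dots,\alpha_S>0$. The hierarchical Dirichlet process (HDP) model is: $p_0\sim\mathrm{DP}(\alpha_0,H)$; given $p_0$, the $p_s\sim\mathrm{DP}(\alpha_s,p_0)$ are independent; given $(p_1,\dots,p_S)$, all observations are independent, those of group $s$ with law $p_s$. For all group sizes and every $s$ let $Q^s_{\boldsymbol\xi^N}$ be the posterior of $p_s$, i.e. a regular conditional distribution of $p_s$ given $\boldsymbol\xi^N$ under this model. As such it is determined only up to null sets of the law of $\boldsymbol\xi^N$ under the model; for each choice of group sizes we assume that one of the following holds: - (a) the true law of $\boldsymbol\xi^N$ is absolutely continuous with respect to its law under the model (the version is then immaterial); or - (b) for each $s$, at every sample without ties the version is the usual one: the law of $p_s$ obtained from $$p_0\sim \mathrm{DP}\Big(\alpha_0+N,\ \tfrac{N}{\alpha_0+N}\,p_{\boldsymbol\xi^N}+\tfrac{\alpha_0}{\alpha_0+N}H\Big),\qquad p_s\mid p_0\sim\mathrm{DP}\Big(\alpha_s+N_s,\ \tfrac{N_s}{\alpha_s+N_s}\,p_{\boldsymbol\xi_s}+\tfrac{\alpha_s}{\alpha_s+N_s}\,p_0\Big).$$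 *Criterion.* For $n\ge1$ let $\phi_n$ be strictly increasing and convex on $[0,K]$ and twice continuously differentiable on $(0,K)$; put $F_{\phi_n}=\sup_{t\in(0,K)}\phi_n'(t)$ and $S_{\phi_n}=\sup_{t\in(0,K)}\phi_n''(t)$ (read as $0$ if $K=0$). The criterion for group $s$ is $$V^s_{\boldsymbol\xi^N}(\theta)=\int_{\mathcal P_\Xi}\phi_{N_s}\big(\mathcal R_p(\theta)\big)\,Q^s_{\boldsymbol\xi^N}(\mathrm dp).$$ For each $s$ let $\theta^s_\star\in\arg\min_{\theta\in\Theta}\mathcal R_{p^\star_s}(\theta)$ and, almost surely for all group sizes, $\theta^s_N\in\arg\min_{\theta\in\Theta}V^s_{\boldsymbol\xi^N}(\theta)$ (these minimizers are assumed to exist). **Theorem.** Assume that for all $s=1,\dots,S$, almost surely, $$\lim_{N_s\to\infty}\sup_{\theta\in\Theta}\big|\mathcal R_{p_{\boldsymbol\xi_s}}(\theta)-\mathcal R_{p^\star_s}(\theta)\big|=0,$$ and that (1) $\lim_{n\to\infty}S_{\phi_n}=0$, (2) $\sup_{n\ge1}F_{\phi_n}<\infty$, (3) $\lim_{n\to\infty}\sup_{t\in[0,K]}|\phi_n(t)-t|=0$.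 Then, almost surely, for every group $s=1,\dots,S$, $$\lim_{N_s\to\infty}\mathcal R_{p^\star_s}(\theta^s_N)=\mathcal R_{p^\star_s}(\theta^s_\star),\qquad \lim_{N_s\to\infty}V^s_{\boldsymbol\xi^N}(\theta^s_N)=\mathcal R_{p^\star_s}(\theta^s_\star),$$ where the limits $N_s\to\infty$ are uniform in the sizes $N_\ell\ge1$, $\ell\ne s$, of the other groups. -/

import Mathlib

open MeasureTheory ProbabilityTheory Filter Topology
open scoped ENNReal

noncomputable section

namespace HDPRobust

/-! ### Risks, empirical measures, slope and curvature -/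

/-- The risk `R_p(θ) = E_{ξ ∼ p}[h(θ, ξ)]`. -/
def risk {Θ Ξ : Type*} [MeasurableSpace Ξ] (h : Θ → Ξ → ℝ) (p : Measure Ξ) (θ : Θ) : ℝ :=
  ∫ x, h θ x ∂p

/-- The empirical distribution of a finite family of points. -/
def empirical {Ξ ι : Type*} [MeasurableSpace Ξ] [Fintype ι] (x : ι → Ξ) : Measure Ξ :=
  (Fintype.card ι : ℝ≥0∞)⁻¹ • ∑ i, Measure.dirac (x i)

/-- `F_φ`, the supremum of `φ'` over `(0, K)`, with values in `[0, ∞]`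
(`φ'` is nonnegative, since `φ` is increasing). -/
def slopeSup (K : ℝ) (φ : ℝ → ℝ) : ℝ≥0∞ :=
  ⨆ t ∈ Set.Ioo (0 : ℝ) K, ENNReal.ofReal (deriv φ t)

/-- `S_φ`, the supremum of `φ''` over `(0, K)`, with values in `[0, ∞]`
(`φ''` is nonnegative, since `φ` is convex). -/
def curvatureSup (K : ℝ) (φ : ℝ → ℝ) : ℝ≥0∞ :=
  ⨆ t ∈ Set.Ioo (0 : ℝ) K, ENNReal.ofReal (deriv (deriv φ) t)

/-! ### Dirichlet distributions and Dirichlet processes -/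

/-- The Gamma law with shape `a ≥ 0` and rate `1`; shape `0` gives the point mass at `0`. -/
def gammaLaw (a : ℝ) : Measure ℝ :=
  if a = 0 then Measure.dirac 0 else gammaMeasure a 1

/-- The Dirichlet distribution with parameters `a i ≥ 0`, not all zero: the law of
`(G_i / ∑ j, G_j)_i` for independent `G_i ∼ Gamma(a i, 1)`.  A coordinate with parameter `0`
vanishes almost surely. -/
def dirichlet {ι : Type*} [Fintype ι] (a : ι → ℝ) : Measure (ι → ℝ) :=
  (Measure.pi fun i => gammaLaw (a i)).map (fun g i => g i / ∑ j, g j)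

/-- `Λ` is the law `DP(α, P)` of the Dirichlet process: for each finite measurable partition
`A_1, …, A_k`, if `p ∼ Λ` then
`(p(A_1), …, p(A_k)) ∼ Dirichlet(α P(A_1), …, α P(A_k))`. -/
def IsDirichletProcess {Ξ : Type*} [MeasurableSpace Ξ] (α : ℝ) (P : Measure Ξ)
    (Λ : Measure (ProbabilityMeasure Ξ)) : Prop :=
  ∀ (k : ℕ) (A : Fin k → Set Ξ), (∀ i, MeasurableSet (A i)) →
    Pairwise (fun i j => Disjoint (A i) (A j)) → (⋃ i, A i) = Set.univ →
    Λ.map (fun (p : ProbabilityMeasure Ξ) i => (p : Measure Ξ).real (A i)) =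
      dirichlet (fun i => α * P.real (A i))

/-! ### The hierarchical model -/

/-- The kernel `a ↦ ⨂ i, κ i a` of a finite family of Markov kernels. -/
def piKernel {A ι : Type*} {X : ι → Type*} [MeasurableSpace A] [Fintype ι]
    [∀ i, MeasurableSpace (X i)] (κ : ∀ i, Kernel A (X i)) [∀ i, IsMarkovKernel (κ i)] :
    Kernel A (∀ i, X i) where
  toFun a := Measure.pi fun i => κ i a
  measurable' := by
    refine Measurable.measure_of_isPiSystem_of_isProbabilityMeasure
      generateFrom_pi.symm isPiSystem_pi ?_
    rintro _ ⟨t, ht, rfl⟩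
    simp only [Measure.pi_pi]
    exact Finset.measurable_prod _ fun i _ =>
      Kernel.measurable_coe (κ i) (ht i (Set.mem_univ i))

instance {A ι : Type*} {X : ι → Type*} [MeasurableSpace A] [Fintype ι]
    [∀ i, MeasurableSpace (X i)] (κ : ∀ i, Kernel A (X i)) [∀ i, IsMarkovKernel (κ i)] :
    IsMarkovKernel (piKernel κ) where
  isProbabilityMeasure a :=
    inferInstanceAs (IsProbabilityMeasure (Measure.pi fun i => κ i a))

/-- `Q` is the law of `(p_1, …, p_S)` under the hierarchical Dirichlet process:
`p_0 ∼ DP(α₀, H)` and, given `p_0`, the `p_s ∼ DP(α_s, p_0)` are independent. -/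
def IsHDP {Ξ : Type*} [MeasurableSpace Ξ] {S : ℕ} (α₀ : ℝ) (α : Fin S → ℝ) (H : Measure Ξ)
    (Q : Measure (Fin S → ProbabilityMeasure Ξ)) : Prop :=
  ∃ (Λ : Measure (ProbabilityMeasure Ξ))
    (D : Fin S → Kernel (ProbabilityMeasure Ξ) (ProbabilityMeasure Ξ))
    (_ : ∀ s, IsMarkovKernel (D s)),
    IsDirichletProcess α₀ H Λ ∧
    (∀ s (p₀ : ProbabilityMeasure Ξ), IsDirichletProcess (α s) (p₀ : Measure Ξ) (D s p₀)) ∧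
    Q = Λ.bind (piKernel D)

/-- Samples `(ξ_{sj})`, `s ≤ S`, `j ≤ N_s`, for group sizes `N = (N_1, …, N_S)`. -/
abbrev Sample (Ξ : Type*) {S : ℕ} (N : Fin S → ℕ+) : Type _ :=
  (s : Fin S) → Fin (N s : ℕ) → Ξ

/-- One draw from the coordinate `p_s` of `(p_1, …, p_S)`. -/
def drawKernel (Ξ : Type*) [MeasurableSpace Ξ] {S : ℕ} (s : Fin S) :
    Kernel (Fin S → ProbabilityMeasure Ξ) Ξ where
  toFun p := (p s : Measure Ξ)
  measurable' := measurable_subtype_coe.comp (measurable_pi_apply s)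

instance (Ξ : Type*) [MeasurableSpace Ξ] {S : ℕ} (s : Fin S) :
    IsMarkovKernel (drawKernel Ξ s) where
  isProbabilityMeasure p := inferInstanceAs (IsProbabilityMeasure (p s : Measure Ξ))

/-- The law of the sample given `(p_1, …, p_S)`: all `ξ_{sj}` are independent, `ξ_{sj} ∼ p_s`. -/
def sampleKernel (Ξ : Type*) [MeasurableSpace Ξ] {S : ℕ} (N : Fin S → ℕ+) :
    Kernel (Fin S → ProbabilityMeasure Ξ) (Sample Ξ N) :=
  piKernel fun s => piKernel fun _ : Fin (N s : ℕ) => drawKernel Ξ s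

/-- The joint law of `((p_1, …, p_S), sample)` under the Bayesian model with prior `Q`. -/
def jointLaw {Ξ : Type*} [MeasurableSpace Ξ] {S : ℕ}
    (Q : Measure (Fin S → ProbabilityMeasure Ξ)) (N : Fin S → ℕ+) :
    Measure ((Fin S → ProbabilityMeasure Ξ) × Sample Ξ N) :=
  Q ⊗ₘ sampleKernel Ξ N

/-- The marginal law of the sample under the Bayesian model with prior `Q`. -/
def marginalLaw {Ξ : Type*} [MeasurableSpace Ξ] {S : ℕ}
    (Q : Measure (Fin S → ProbabilityMeasure Ξ)) (N : Fin S → ℕ+) : Measure (Sample Ξ N) :=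
  (jointLaw Q N).map Prod.snd

/-- `κ` is a regular conditional distribution of `p_s` given the sample, under the model with
prior `Q`. -/
def IsPosterior {Ξ : Type*} [MeasurableSpace Ξ] {S : ℕ}
    (Q : Measure (Fin S → ProbabilityMeasure Ξ)) (N : Fin S → ℕ+) (s : Fin S)
    (κ : Kernel (Sample Ξ N) (ProbabilityMeasure Ξ)) : Prop :=
  IsMarkovKernel κ ∧ marginalLaw Q N ⊗ₘ κ = (jointLaw Q N).map (fun z => (z.2, z.1 s))

/-! ### The tie-free version of the posterior -/

/-- All observations, within and across groups, are distinct. -/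
def TieFree {Ξ : Type*} {S : ℕ} {N : Fin S → ℕ+} (x : Sample Ξ N) : Prop :=
  Function.Injective fun i : (s : Fin S) × Fin (N s : ℕ) => x i.1 i.2

/-- The updated centering distribution `n/(α+n) · empirical + α/(α+n) · P`, where `n` is the
number of points. -/
def updatedCenter {Ξ ι : Type*} [MeasurableSpace Ξ] [Fintype ι] (α : ℝ) (P : Measure Ξ)
    (x : ι → Ξ) : Measure Ξ :=
  ENNReal.ofReal (Fintype.card ι / (α + Fintype.card ι)) • empirical x +
    ENNReal.ofReal (α / (α + Fintype.card ι)) • P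

/-- `q` is the law of `p_s` when `p_0 ∼ DP(α₀ + N, N/(α₀+N) · pooled empirical + α₀/(α₀+N) · H)`
and, given `p_0`, `p_s ∼ DP(α_s + N_s, N_s/(α_s+N_s) · group empirical + α_s/(α_s+N_s) · p_0)`. -/
def IsTwoStageLaw {Ξ : Type*} [MeasurableSpace Ξ] {S : ℕ} {N : Fin S → ℕ+}
    (α₀ : ℝ) (α : Fin S → ℝ) (H : Measure Ξ) (s : Fin S) (x : Sample Ξ N)
    (q : Measure (ProbabilityMeasure Ξ)) : Prop :=
  ∃ (Λ : Measure (ProbabilityMeasure Ξ))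
    (D : Kernel (ProbabilityMeasure Ξ) (ProbabilityMeasure Ξ)),
    IsDirichletProcess (α₀ + ∑ l, (N l : ℕ))
      (updatedCenter α₀ H fun i : (l : Fin S) × Fin (N l : ℕ) => x i.1 i.2) Λ ∧
    (∀ p₀ : ProbabilityMeasure Ξ,
      IsDirichletProcess (α s + (N s : ℕ)) (updatedCenter (α s) (p₀ : Measure Ξ) (x s)) (D p₀)) ∧
    q = Λ.bind D

/-! ### The robust criterion -/

/-- The criterion `V(θ) = ∫ φ(R_p(θ)) q(dp)`. -/
def criterion {Θ Ξ : Type*} [MeasurableSpace Ξ] (h : Θ → Ξ → ℝ) (φ : ℝ → ℝ)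
    (q : Measure (ProbabilityMeasure Ξ)) (θ : Θ) : ℝ :=
  ∫ p, φ (risk h (p : Measure Ξ) θ) ∂q

end HDPRobust

end

noncomputable section

namespace HDPRobust

/-! ### Gamma laws -/

/-! The criterion of group `s` is uniformly close to the true risk, so its minimizers are nearly
optimal (`abs_sub_le_of_isMinOn`). The error has three parts: the distance of `φ` from the identity,
the distance between the posterior expected risk and the empirical risk, and the distance between
empirical and true risk. The first and third vanish by assumption, and the work is in the second.

The posterior expected risk is the risk under the posterior mean measure `m` of `p_s`. The key fact
is that `(α_s + N_s) m` dominates the counting measure of the observations of group `s`. The excess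
has total mass `α_s`, so for losses in `[0, K]` the two risks differ by at most `α_s K / (α_s +
N_s)` (`abs_integral_risk_sub_le`). This bound does not involve the other groups, whence the
uniformity in their sizes.

For a version that is determined almost everywhere, the domination is `sum_dirac_le_posterior_mean`:
given `p_0`, the Pólya urn identity (`IsDirichletProcess.lintegral_mul_prod`) splits `(α_s + N_s) m`
into the counting measure plus `α_s` times the posterior mean of `p_0`, about which nothing need be
known. For the explicit version, it can be read off the mean of the inner Dirichlet process
(`IsTwoStageLaw.sum_dirac_le`); that version applies because independent diffuse observations almost
surely have no ties.

The urn identity is proved for Dirichlet vectors by induction from size-biasing, which comes from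
normalized Gamma variables. -/

theorem isProbabilityMeasure_gammaLaw {a : ℝ} (ha : 0 ≤ a) : IsProbabilityMeasure (gammaLaw a) := by
  unfold gammaLaw
  split_ifs with h
  · infer_instance
  · exact isProbabilityMeasure_gammaMeasure (lt_of_le_of_ne ha (Ne.symm h)) one_pos

theorem gammaLaw_ae_nonneg (a : ℝ) : ∀ᵐ x ∂gammaLaw a, 0 ≤ x := by
  unfold gammaLaw
  split_ifs with h
  · simp [ae_dirac_eq]
  · rw [gammaMeasure, ae_withDensity_iff
      (show Measurable (gammaPDF a 1) from (measurable_gammaPDFReal a 1).ennreal_ofReal)]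
    refine ae_of_all _ fun x hx => ?_
    by_contra hneg
    exact hx (gammaPDF_of_neg (not_le.1 hneg))

theorem gammaLaw_ae_pos {a : ℝ} (ha : a ≠ 0) : ∀ᵐ x ∂gammaLaw a, 0 < x := by
  have h0 : gammaLaw a {0} = 0 := by
    rw [gammaLaw, if_neg ha, gammaMeasure]
    exact withDensity_absolutelyContinuous _ _ (by simp)
  filter_upwards [gammaLaw_ae_nonneg a, compl_mem_ae_iff.2 h0] with x hx hx0
  exact lt_of_le_of_ne hx (fun h => hx0 h.symm)

/-- Since `Γ(a + 1) = a Γ(a)`, the extra factor `x` in the density only raises the shape. For `a =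
0` both sides vanish, so empty cells of a partition need no separate treatment later. -/
theorem gammaLaw_withDensity_id {a : ℝ} (ha : 0 ≤ a) :
    (gammaLaw a).withDensity ENNReal.ofReal = ENNReal.ofReal a • gammaLaw (a + 1) := by
  rcases ha.eq_or_lt with rfl | ha
  · simp [gammaLaw, dirac_withDensity]
  have hm (b : ℝ) : Measurable (gammaPDF b 1) := (measurable_gammaPDFReal b 1).ennreal_ofReal
  rw [gammaLaw, gammaLaw, if_neg ha.ne', if_neg (by positivity), gammaMeasure, gammaMeasure,
    ← withDensity_mul _ (hm a) ENNReal.measurable_ofReal, ← withDensity_smul _ (hm _)]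
  congr 1
  ext x
  simp only [Pi.mul_apply, Pi.smul_apply, smul_eq_mul]
  rcases lt_or_ge x 0 with hx | hx
  · simp [gammaPDF_of_neg hx]
  have hΓ := Real.Gamma_pos_of_pos ha
  rw [gammaPDF_of_nonneg hx, gammaPDF_of_nonneg hx, ← ENNReal.ofReal_mul (by positivity),
    ← ENNReal.ofReal_mul ha.le, Real.Gamma_add_one ha.ne']
  congr 1
  have : x ^ (a + 1 - 1) = x ^ (a - 1) * x := by
    rcases hx.eq_or_lt with rfl | hx
    · simp [ha.ne']
    · rw [← Real.rpow_add_one hx.ne']; ring_nf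
  rw [this, Real.one_rpow, Real.one_rpow]
  field_simp

theorem lintegral_comp_const_mul {c : ℝ} (hc : 0 < c) {f : ℝ → ℝ≥0∞} (hf : Measurable f) :
    ∫⁻ x, f (c * x) = ENNReal.ofReal c⁻¹ * ∫⁻ x, f x := by
  have h := lintegral_map (μ := volume) hf (measurable_const_mul c)
  rw [Real.map_volume_mul_left hc.ne', lintegral_smul_measure, abs_of_pos (inv_pos.2 hc)] at h
  simpa using h.symm

/-- Exponential tilting of a Gamma law is a rescaling. -/
theorem gammaLaw_withDensity_exp {a : ℝ} (ha : 0 ≤ a) {u : ℝ} (hu : 0 ≤ u) :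
    (gammaLaw a).withDensity (fun x => ENNReal.ofReal (Real.exp (-(u * x)))) =
      ENNReal.ofReal ((1 + u) ^ (-a)) • (gammaLaw a).map (fun x => (1 + u)⁻¹ * x) := by
  have hc : (0 : ℝ) < 1 + u := by positivity
  rcases ha.eq_or_lt with rfl | ha
  · simp [gammaLaw, dirac_withDensity, Measure.map_dirac]
  have hm : Measurable (gammaPDF a 1) := (measurable_gammaPDFReal a 1).ennreal_ofReal
  have he : Measurable (fun x : ℝ => ENNReal.ofReal (Real.exp (-(u * x)))) := by fun_prop
  rw [gammaLaw, if_neg ha.ne', gammaMeasure, ← withDensity_mul _ hm he]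
  ext s hs
  rw [withDensity_apply _ hs, Measure.smul_apply, Measure.map_apply (by fun_prop) hs,
    withDensity_apply _ (hs.preimage (by fun_prop)), ← lintegral_indicator hs,
    ← lintegral_indicator (hs.preimage (by fun_prop))]
  -- Substituting `(1 + u) * x` in the integral turns the pulled-back indicator into that of `s`, so
  -- that the two integrands can be compared pointwise.
  have key := lintegral_comp_const_mul hc
    (f := ((fun x => (1 + u)⁻¹ * x) ⁻¹' s).indicator (gammaPDF a 1))
    (hm.indicator (hs.preimage (by fun_prop)))
  have h1 : ∫⁻ x, ((fun x => (1 + u)⁻¹ * x) ⁻¹' s).indicator (gammaPDF a 1) x =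
      ENNReal.ofReal (1 + u) *
        ∫⁻ x, ((fun x => (1 + u)⁻¹ * x) ⁻¹' s).indicator (gammaPDF a 1) ((1 + u) * x) := by
    rw [key, ← mul_assoc, ← ENNReal.ofReal_mul hc.le, mul_inv_cancel₀ hc.ne']
    simp
  rw [h1, smul_eq_mul, ← mul_assoc, ← ENNReal.ofReal_mul (by positivity),
    ← lintegral_const_mul' _ _ (by simp)]
  refine lintegral_congr fun x => ?_
  have hxs : (1 + u) * x ∈ (fun x => (1 + u)⁻¹ * x) ⁻¹' s ↔ x ∈ s := by
    simp [inv_mul_cancel_left₀ hc.ne']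
  by_cases hx : x ∈ s
  · rw [Set.indicator_of_mem hx, Set.indicator_of_mem (hxs.2 hx)]
    simp only [Pi.mul_apply]
    rcases lt_or_ge x 0 with hx0 | hx0
    · rw [gammaPDF_of_neg hx0, gammaPDF_of_neg (mul_neg_of_pos_of_neg hc hx0)]; simp
    · have hΓ := Real.Gamma_pos_of_pos ha
      rw [gammaPDF_of_nonneg hx0, gammaPDF_of_nonneg (by positivity),
        ← ENNReal.ofReal_mul (by positivity), ← ENNReal.ofReal_mul (by positivity)]
      congr 1
      rw [Real.mul_rpow hc.le hx0, show -(1 * ((1 + u) * x)) = -(1 * x) + -(u * x) by ring,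
        Real.exp_add]
      -- The three powers are the mass of the tilted law, the Jacobian, and the rescaled Gamma
      -- density.
      have : (1 + u) ^ (-a) * (1 + u) * (1 + u) ^ (a - 1) = 1 := by
        rw [← Real.rpow_add_one hc.ne', ← Real.rpow_add hc]
        simp
      linear_combination (-(1 ^ a / Real.Gamma a * x ^ (a - 1) *
        (Real.exp (-(1 * x)) * Real.exp (-(u * x))))) * this
  · rw [Set.indicator_of_notMem hx, Set.indicator_of_notMem (fun h => hx (hxs.1 h))]; simp

/-! ### Products of Gamma laws -/

theorem lintegral_pi_prod {ι : Type*} [Fintype ι] {X : ι → Type*} [∀ i, MeasurableSpace (X i)]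
    (μ : ∀ i, Measure (X i)) [∀ i, IsProbabilityMeasure (μ i)] {f : ∀ i, X i → ℝ≥0∞}
    (hf : ∀ i, Measurable (f i)) :
    ∫⁻ x, ∏ i, f i (x i) ∂Measure.pi μ = ∏ i, ∫⁻ y, f i y ∂μ i := by
  rw [lintegral_prod_eq_prod_lintegral_of_indepFun Finset.univ
    (fun i (x : ∀ i, X i) => f i (x i))
    (iIndepFun_pi fun i => (hf i).aemeasurable) (fun i => (hf i).comp (measurable_pi_apply i))]
  exact Finset.prod_congr rfl fun i _ => (measurePreserving_eval μ i).lintegral_comp (hf i)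

theorem pi_withDensity_prod {ι : Type*} [Fintype ι] {X : ι → Type*} [∀ i, MeasurableSpace (X i)]
    (μ : ∀ i, Measure (X i)) [∀ i, IsProbabilityMeasure (μ i)] (f : ∀ i, X i → ℝ≥0∞)
    (hf : ∀ i, Measurable (f i)) [∀ i, SigmaFinite ((μ i).withDensity (f i))] :
    (Measure.pi μ).withDensity (fun x => ∏ i, f i (x i)) =
      Measure.pi fun i => (μ i).withDensity (f i) := by
  refine (Measure.pi_eq fun s hs => ?_).symm
  rw [withDensity_apply _ (MeasurableSet.univ_pi hs),
    ← lintegral_indicator (MeasurableSet.univ_pi hs)]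
  have h1 (x : ∀ i, X i) : (Set.univ.pi s).indicator (fun x => ∏ i, f i (x i)) x =
      ∏ i, (s i).indicator (f i) (x i) := by
    by_cases hx : x ∈ Set.univ.pi s
    · rw [Set.indicator_of_mem hx]
      exact Finset.prod_congr rfl fun i _ => (Set.indicator_of_mem (hx i trivial) _).symm
    · rw [Set.indicator_of_notMem hx]
      obtain ⟨i, hi⟩ : ∃ i, x i ∉ s i := by simpa [Set.mem_pi] using hx
      exact (Finset.prod_eq_zero (Finset.mem_univ i) (Set.indicator_of_notMem hi _)).symm
  simp_rw [h1]
  rw [lintegral_pi_prod μ fun i => (hf i).indicator (hs i)]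
  refine Finset.prod_congr rfl fun i _ => ?_
  rw [withDensity_apply _ (hs i), ← lintegral_indicator (hs i)]

theorem pi_smul_measure {ι : Type*} [Fintype ι] {X : ι → Type*} [∀ i, MeasurableSpace (X i)]
    (μ : ∀ i, Measure (X i)) [∀ i, SigmaFinite (μ i)] (c : ι → ℝ≥0∞)
    [∀ i, SigmaFinite (c i • μ i)] :
    Measure.pi (fun i => c i • μ i) = (∏ i, c i) • Measure.pi μ := by
  refine Measure.pi_eq fun s hs => ?_
  simp [Measure.pi_pi, Finset.prod_mul_distrib]

/-- The law of independent Gamma variables with shapes `a i`. -/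
def gammaPi {ι : Type*} [Fintype ι] (a : ι → ℝ) : Measure (ι → ℝ) :=
  Measure.pi fun i => gammaLaw (a i)

theorem add_single_nonneg {ι : Type*} [DecidableEq ι] {a : ι → ℝ} (ha : ∀ i, 0 ≤ a i) (c i : ι) :
    0 ≤ (a + Pi.single c 1 : ι → ℝ) i := by
  by_cases h : i = c
  · subst h
    simp only [Pi.add_apply, Pi.single_eq_same]
    linarith [ha i]
  · simpa [h] using ha i

section gammaPi

variable {ι : Type*} [Fintype ι] {a : ι → ℝ}

theorem isProbabilityMeasure_gammaPi (ha : ∀ i, 0 ≤ a i) : IsProbabilityMeasure (gammaPi a) := by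
  have := fun i => isProbabilityMeasure_gammaLaw (ha i)
  unfold gammaPi; infer_instance

theorem gammaPi_ae_eval (ha : ∀ i, 0 ≤ a i) (i : ι) {p : ℝ → Prop}
    (h : ∀ᵐ x ∂gammaLaw (a i), p x) : ∀ᵐ g ∂gammaPi a, p (g i) := by
  have := fun i => isProbabilityMeasure_gammaLaw (ha i)
  exact (measurePreserving_eval (fun i => gammaLaw (a i)) i).quasiMeasurePreserving.ae h

theorem gammaPi_ae_nonneg (ha : ∀ i, 0 ≤ a i) : ∀ᵐ g ∂gammaPi a, ∀ i, 0 ≤ g i :=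
  ae_all_iff.2 fun i => gammaPi_ae_eval ha i (gammaLaw_ae_nonneg (a i))

theorem gammaPi_ae_sum_pos (ha : ∀ i, 0 ≤ a i) (hpos : 0 < ∑ i, a i) :
    ∀ᵐ g ∂gammaPi a, 0 < ∑ i, g i := by
  obtain ⟨i, -, hi⟩ := Finset.exists_lt_of_sum_lt (s := Finset.univ) (f := fun _ => (0 : ℝ))
    (g := a) (by simpa using hpos)
  filter_upwards [gammaPi_ae_nonneg ha, gammaPi_ae_eval ha i (gammaLaw_ae_pos hi.ne')] with g h0 h1
  exact Finset.sum_pos' (fun i _ => h0 i) ⟨i, Finset.mem_univ i, h1⟩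

theorem sum_add_single [DecidableEq ι] (a : ι → ℝ) (c : ι) :
    ∑ i, (a + Pi.single c 1 : ι → ℝ) i = ∑ i, a i + 1 := by
  simp [Finset.sum_add_distrib]

/-- The density is a product whose factors are `1` away from `c`, so only the coordinate `c`
changes. -/
theorem gammaPi_withDensity_eval [DecidableEq ι] (ha : ∀ i, 0 ≤ a i) (c : ι) :
    (gammaPi a).withDensity (fun g => ENNReal.ofReal (g c)) =
      ENNReal.ofReal (a c) • gammaPi (a + Pi.single c 1) := by
  have := fun i => isProbabilityMeasure_gammaLaw (ha i)
  have := fun i => isProbabilityMeasure_gammaLaw (add_single_nonneg ha c i)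
  have h1 (i) : (gammaLaw (a i)).withDensity (if i = c then ENNReal.ofReal else 1) =
      (if i = c then ENNReal.ofReal (a c) else 1) • gammaLaw ((a + Pi.single c 1 : ι → ℝ) i) := by
    split_ifs with h
    · subst h; simpa using gammaLaw_withDensity_id (ha i)
    · simp [h]
  have inst1 (i) : IsFiniteMeasure ((if i = c then ENNReal.ofReal (a c) else 1) •
      gammaLaw ((a + Pi.single c 1 : ι → ℝ) i)) :=
    Measure.smul_finite _ (by split_ifs <;> simp)
  have inst2 (i) : SigmaFinite ((gammaLaw (a i)).withDensity (if i = c then ENNReal.ofReal else 1)) := by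
    rw [h1]; infer_instance
  have h2 := pi_withDensity_prod (fun i => gammaLaw (a i))
    (fun i => if i = c then ENNReal.ofReal else 1)
    (fun i => by split_ifs; exacts [ENNReal.measurable_ofReal, measurable_const])
  simp_rw [h1] at h2
  rw [pi_smul_measure] at h2
  simp only [Finset.prod_ite_eq', Finset.mem_univ, if_true] at h2
  rw [gammaPi, gammaPi, ← h2]
  congr 1
  ext g
  rw [Finset.prod_eq_single c (by intro i _ h; simp [h]) (by simp)]
  simp

/-- The exponential of the sum factorizes, and every coordinate is rescaled by the same `(1 + u)⁻¹`,
a change that normalization does not see. -/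
theorem gammaPi_withDensity_exp (ha : ∀ i, 0 ≤ a i) {u : ℝ} (hu : 0 ≤ u) :
    (gammaPi a).withDensity (fun g => ENNReal.ofReal (Real.exp (-(u * ∑ i, g i)))) =
      ENNReal.ofReal ((1 + u) ^ (-∑ i, a i)) •
        (gammaPi a).map (fun g i => (1 + u)⁻¹ * g i) := by
  have hc : (0 : ℝ) < 1 + u := by positivity
  have := fun i => isProbabilityMeasure_gammaLaw (ha i)
  have h1 (i) := gammaLaw_withDensity_exp (ha i) hu
  have inst3 (i) : IsProbabilityMeasure ((gammaLaw (a i)).map (fun x => (1 + u)⁻¹ * x)) :=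
    Measure.isProbabilityMeasure_map (by fun_prop)
  have inst4 (i) : IsFiniteMeasure (ENNReal.ofReal ((1 + u) ^ (-(a i))) •
      (gammaLaw (a i)).map (fun x => (1 + u)⁻¹ * x)) :=
    Measure.smul_finite _ (by simp)
  have inst5 (i) : SigmaFinite ((gammaLaw (a i)).withDensity
      (fun x => ENNReal.ofReal (Real.exp (-(u * x))))) := by
    rw [h1]; infer_instance
  have h2 := pi_withDensity_prod (fun i => gammaLaw (a i))
    (fun _ x => ENNReal.ofReal (Real.exp (-(u * x)))) (fun i => by fun_prop)
  simp_rw [h1] at h2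
  rw [pi_smul_measure, ← Measure.pi_map_pi (fun i => by fun_prop),
    ← ENNReal.ofReal_prod_of_nonneg (fun i _ => by positivity),
    ← Real.rpow_sum_of_pos hc, Finset.sum_neg_distrib] at h2
  rw [gammaPi, ← h2]
  congr 1
  ext g
  rw [← ENNReal.ofReal_prod_of_nonneg (fun i _ => by positivity), ← Real.exp_sum,
    Finset.sum_neg_distrib, Finset.mul_sum]

/-! ### Normalization and size-biasing. -/

theorem lintegral_Ioi_exp_neg_mul {w : ℝ} (hw : 0 < w) :
    ∫⁻ u in Set.Ioi (0 : ℝ), ENNReal.ofReal (Real.exp (-(u * w))) = (ENNReal.ofReal w)⁻¹ := by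
  have hi : IntegrableOn (fun u : ℝ => Real.exp (-w * u)) (Set.Ioi 0) :=
    integrableOn_exp_mul_Ioi (by linarith) 0
  have h := ofReal_integral_eq_lintegral_ofReal hi (ae_of_all _ fun u => by positivity)
  rw [integral_exp_mul_Ioi (by linarith)] at h
  rw [← ENNReal.ofReal_inv_of_pos hw]
  simp only [mul_zero, Real.exp_zero, neg_div_neg_eq, one_div] at h
  rw [h]
  simp [mul_comm]

/-- Normalization of a vector by the sum of its coordinates. -/
def normalize (g : ι → ℝ) : ι → ℝ := fun i => g i / ∑ j, g j

theorem measurable_normalize : Measurable (normalize : (ι → ℝ) → ι → ℝ) := by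
  unfold normalize; fun_prop

theorem normalize_const_mul {c : ℝ} (hc : c ≠ 0) (g : ι → ℝ) :
    normalize (fun i => c * g i) = normalize g := by
  ext i
  rw [normalize, normalize, ← Finset.mul_sum, mul_div_mul_left _ _ hc]

/-- Write `1 / w` as `∫ exp (-u w) du` and exchange the integrals. Each exponential tilt rescales
the Gamma vector, which leaves the normalized vector unchanged. This is the part of the independence
of sum and normalized vector that is needed, obtained without a multivariate change of variables. -/
theorem lintegral_inv_sum_mul (ha : ∀ i, 0 ≤ a i) (hpos : 0 < ∑ i, a i)
    {F : (ι → ℝ) → ℝ≥0∞} (hF : Measurable F) :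
    ∫⁻ g, (ENNReal.ofReal (∑ i, g i))⁻¹ * F (normalize g) ∂gammaPi a =
      (∫⁻ u in Set.Ioi (0 : ℝ), ENNReal.ofReal ((1 + u) ^ (-∑ i, a i))) *
        ∫⁻ g, F (normalize g) ∂gammaPi a := by
  have := isProbabilityMeasure_gammaPi ha
  have hFn : Measurable fun g : ι → ℝ => F (normalize g) := hF.comp measurable_normalize
  calc _ = ∫⁻ g : ι → ℝ, ∫⁻ u : ℝ in Set.Ioi (0 : ℝ),
        ENNReal.ofReal (Real.exp (-(u * ∑ i, g i))) * F (normalize g) ∂volume ∂gammaPi a := by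
        refine lintegral_congr_ae ?_
        filter_upwards [gammaPi_ae_sum_pos ha hpos] with g hg
        rw [lintegral_mul_const _ (by fun_prop), lintegral_Ioi_exp_neg_mul hg]
    _ = ∫⁻ u in Set.Ioi (0 : ℝ), ∫⁻ g,
        ENNReal.ofReal (Real.exp (-(u * ∑ i, g i))) * F (normalize g) ∂gammaPi a := by
        refine lintegral_lintegral_swap (Measurable.aemeasurable ?_)
        exact Measurable.mul (by fun_prop) (hFn.comp measurable_fst)
    _ = ∫⁻ u in Set.Ioi (0 : ℝ), ENNReal.ofReal ((1 + u) ^ (-∑ i, a i)) *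
        ∫⁻ g, F (normalize g) ∂gammaPi a := by
        refine setLIntegral_congr_fun measurableSet_Ioi fun u hu => ?_
        have hu : (0 : ℝ) < u := hu
        have h := lintegral_withDensity_eq_lintegral_mul (gammaPi a)
          (f := fun g => ENNReal.ofReal (Real.exp (-(u * ∑ i, g i)))) (by fun_prop) hFn
        rw [gammaPi_withDensity_exp ha hu.le, lintegral_smul_measure,
          lintegral_map hFn (by fun_prop)] at h
        simp_rw [normalize_const_mul (inv_ne_zero (by positivity : (1 + u) ≠ 0))] at h
        exact h.symm
    _ = _ := lintegral_mul_const _ (by fun_prop)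

/-- Size-biasing a Dirichlet law by one coordinate adds `1` to the corresponding parameter. -/
theorem sum_mul_lintegral_normalize_mul [DecidableEq ι] (ha : ∀ i, 0 ≤ a i)
    (hpos : 0 < ∑ i, a i) (c : ι) {F : (ι → ℝ) → ℝ≥0∞} (hF : Measurable F) :
    ENNReal.ofReal (∑ i, a i) *
        ∫⁻ g, ENNReal.ofReal (normalize g c) * F (normalize g) ∂gammaPi a =
      ENNReal.ofReal (a c) * ∫⁻ g, F (normalize g) ∂gammaPi (a + Pi.single c 1) := by
  -- `C` does not depend on the coordinate, because raising any one shape by `1` gives the same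
  -- total.
  set C := ∫⁻ u in Set.Ioi (0 : ℝ), ENNReal.ofReal ((1 + u) ^ (-(∑ i, a i + 1))) with hC
  have key (c : ι) (F : (ι → ℝ) → ℝ≥0∞) (hF : Measurable F) :
      ∫⁻ g, ENNReal.ofReal (normalize g c) * F (normalize g) ∂gammaPi a =
        C * (ENNReal.ofReal (a c) * ∫⁻ g, F (normalize g) ∂gammaPi (a + Pi.single c 1)) := by
    have hFn : Measurable fun g : ι → ℝ => F (normalize g) := hF.comp measurable_normalize
    calc _ = ∫⁻ g, ENNReal.ofReal (g c) *
          ((ENNReal.ofReal (∑ i, g i))⁻¹ * F (normalize g)) ∂gammaPi a := by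
          refine lintegral_congr_ae ?_
          filter_upwards [gammaPi_ae_sum_pos ha hpos] with g hg
          rw [normalize, ENNReal.ofReal_div_of_pos hg, div_eq_mul_inv, mul_assoc]
      _ = ENNReal.ofReal (a c) * ∫⁻ g, (ENNReal.ofReal (∑ i, g i))⁻¹ * F (normalize g)
          ∂gammaPi (a + Pi.single c 1) := by
          have h := lintegral_withDensity_eq_lintegral_mul (gammaPi a)
            (f := fun g => ENNReal.ofReal (g c)) (by fun_prop)
            (g := fun g => (ENNReal.ofReal (∑ i, g i))⁻¹ * F (normalize g))
            (Measurable.mul (by fun_prop) hFn)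
          rw [gammaPi_withDensity_eval ha, lintegral_smul_measure] at h
          exact h.symm
      _ = _ := by
          rw [lintegral_inv_sum_mul (add_single_nonneg ha c)
            (by rw [sum_add_single]; positivity) hF, sum_add_single, ← hC]
          ring
  have := isProbabilityMeasure_gammaPi ha
  -- `C` is found without evaluating the integral: the normalized coordinates sum to `1`, so summing
  -- `key` over `c` with `F = 1` forces its value.
  have hC1 : C * ENNReal.ofReal (∑ i, a i) = 1 := by
    have h1 : ∫⁻ g, ∑ c, ENNReal.ofReal (normalize g c) * 1 ∂gammaPi a = 1 := by
      refine (lintegral_congr_ae (g := fun _ => 1) ?_).trans (by simp)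
      filter_upwards [gammaPi_ae_sum_pos ha hpos, gammaPi_ae_nonneg ha] with g hg hg0
      simp only [mul_one, normalize]
      rw [← ENNReal.ofReal_sum_of_nonneg (fun i _ => div_nonneg (hg0 i) hg.le)]
      rw [← Finset.sum_div, div_self hg.ne', ENNReal.ofReal_one]
    rw [lintegral_finsetSum _ (fun c _ => by
      have := measurable_normalize (ι := ι); fun_prop)] at h1
    rw [← h1, ENNReal.ofReal_sum_of_nonneg (fun i _ => ha i), Finset.mul_sum]
    refine Finset.sum_congr rfl fun c _ => ?_
    have := isProbabilityMeasure_gammaPi (add_single_nonneg ha c)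
    rw [key c (fun _ => 1) measurable_const]
    simp
  rw [key c F hF, ← mul_assoc, mul_comm _ C, hC1, one_mul]

end gammaPi

/-! ### Linear forms in a Dirichlet vector. -/

section Dirichlet

variable {ι : Type*} [Fintype ι]

/-- The linear form `x ↦ ∑ c, v c * x c`, with values in `[0, ∞]`. -/
def linForm (v : ι → ℝ≥0∞) (x : ι → ℝ) : ℝ≥0∞ := ∑ c, v c * ENNReal.ofReal (x c)

theorem measurable_linForm (v : ι → ℝ≥0∞) : Measurable (linForm v) := by
  unfold linForm; fun_prop

theorem sum_mul_lintegral_linForm_mul [DecidableEq ι] {a : ι → ℝ} (ha : ∀ i, 0 ≤ a i)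
    (hpos : 0 < ∑ i, a i) (v : ι → ℝ≥0∞) {F : (ι → ℝ) → ℝ≥0∞} (hF : Measurable F) :
    ENNReal.ofReal (∑ i, a i) *
        ∫⁻ g, linForm v (normalize g) * F (normalize g) ∂gammaPi a =
      ∑ c, v c * ENNReal.ofReal (a c) *
        ∫⁻ g, F (normalize g) ∂gammaPi (a + Pi.single c 1) := by
  have hn := measurable_normalize (ι := ι)
  have hFn : Measurable fun g : ι → ℝ => F (normalize g) := hF.comp hn
  simp only [linForm, Finset.sum_mul]
  rw [lintegral_finsetSum _ (fun c _ => by fun_prop), Finset.mul_sum]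
  refine Finset.sum_congr rfl fun c _ => ?_
  simp_rw [mul_assoc]
  rw [lintegral_const_mul _ (by fun_prop), mul_left_comm,
    sum_mul_lintegral_normalize_mul ha hpos c hF]

/-- The Pólya urn recursion for products of linear forms in a Dirichlet vector. -/
theorem lintegral_linForm_mul_prod [DecidableEq ι] {J : Type*} [DecidableEq J]
    (v : ι → ℝ≥0∞) (u : J → ι → ℝ≥0∞) (s : Finset J) {a : ι → ℝ} (ha : ∀ i, 0 ≤ a i)
    (hpos : 0 < ∑ i, a i) :
    ENNReal.ofReal (∑ i, a i + s.card) *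
        ∫⁻ g, linForm v (normalize g) * ∏ j ∈ s, linForm (u j) (normalize g) ∂gammaPi a =
      linForm v a * ∫⁻ g, ∏ j ∈ s, linForm (u j) (normalize g) ∂gammaPi a +
        ∑ j ∈ s, ∫⁻ g, linForm (u j * v) (normalize g) *
          ∏ i ∈ s.erase j, linForm (u i) (normalize g) ∂gammaPi a := by
  have hl (w : ι → ℝ≥0∞) : Measurable (linForm w) := measurable_linForm w
  induction s using Finset.induction_on generalizing a with
  | empty =>
    have h := sum_mul_lintegral_linForm_mul ha hpos v (F := fun _ => 1) measurable_const
    have := isProbabilityMeasure_gammaPi ha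
    have := fun c => isProbabilityMeasure_gammaPi (add_single_nonneg ha c)
    simpa [linForm] using h
  | insert j₀ s hj ih =>
    have hA0 : ENNReal.ofReal (∑ i, a i) ≠ 0 := by simpa using hpos
    have hp (t : Finset J) : Measurable fun x : ι → ℝ => ∏ j ∈ t, linForm (u j) x :=
      Finset.measurable_prod _ fun j _ => hl _
    have hins (t : Finset J) (ht : j₀ ∉ t) (x : ι → ℝ) :
        ∏ j ∈ insert j₀ t, linForm (u j) x = linForm (u j₀) x * ∏ j ∈ t, linForm (u j) x :=
      Finset.prod_insert ht
    have herase (j) (hjs : j ∈ s) : (insert j₀ s).erase j = insert j₀ (s.erase j) :=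
      Finset.erase_insert_of_ne (fun h => hj (h ▸ hjs))
    have hne (j) (hjs : j ∈ s) : j₀ ∉ s.erase j := fun h => hj (Finset.mem_of_mem_erase h)
    -- Size-biasing by `u j₀` carries the factor `∑ i, a i`; both sides are multiplied by it so that
    -- all terms can be expanded over the shifted parameters.
    refine (ENNReal.mul_right_inj hA0 ENNReal.ofReal_ne_top).1 ?_
    have e1 := sum_mul_lintegral_linForm_mul ha hpos (u j₀)
      (F := fun x => linForm v x * ∏ j ∈ s, linForm (u j) x) ((hl v).mul (hp s))
    have e2 := sum_mul_lintegral_linForm_mul ha hpos (u j₀)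
      (F := fun x => ∏ j ∈ s, linForm (u j) x) (hp s)
    have e3 := sum_mul_lintegral_linForm_mul ha hpos (u j₀ * v)
      (F := fun x => ∏ j ∈ s, linForm (u j) x) (hp s)
    have e4 (j) := sum_mul_lintegral_linForm_mul ha hpos (u j₀)
      (F := fun x => linForm (u j * v) x * ∏ i ∈ s.erase j, linForm (u i) x)
      ((hl (u j * v)).mul (hp _))
    -- The increment `v c` is the source of the new summand `u j₀ * v` in the recursion.
    have hlin (c) : linForm v (a + Pi.single c 1) = linForm v a + v c := by
      simp only [linForm, Pi.add_apply]
      have : ∀ i, ENNReal.ofReal (a i + (Pi.single c 1 : ι → ℝ) i) =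
          ENNReal.ofReal (a i) + if i = c then 1 else 0 := fun i => by
        by_cases h : i = c
        · subst h; simp [ENNReal.ofReal_add (ha i)]
        · simp [h]
      simp [this, mul_add, Finset.sum_add_distrib]
    -- The induction hypothesis is used at the shifted parameters, whose total exceeds the old one
    -- by `1`; this matches the increase of the cardinality.
    have ih' (c) := ih (add_single_nonneg ha c) (by rw [sum_add_single]; positivity)
    simp only [sum_add_single, hlin] at ih'
    simp only [hins s hj, Finset.sum_insert hj, Finset.erase_insert hj]
    rw [Finset.card_insert_of_notMem hj]
    have hcast : ∑ i, a i + ((s.card + 1 : ℕ) : ℝ) = ∑ i, a i + 1 + s.card := by push_cast; ring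
    rw [hcast]
    calc _ = ENNReal.ofReal (∑ i, a i + 1 + s.card) * (ENNReal.ofReal (∑ i, a i) *
          ∫⁻ g, linForm (u j₀) (normalize g) * (linForm v (normalize g) *
            ∏ j ∈ s, linForm (u j) (normalize g)) ∂gammaPi a) := by
          rw [mul_left_comm]; congr 4; ext g; ring
      _ = ∑ c, u j₀ c * ENNReal.ofReal (a c) * ((linForm v a + v c) *
          ∫⁻ g, ∏ j ∈ s, linForm (u j) (normalize g) ∂gammaPi (a + Pi.single c 1) +
          ∑ j ∈ s, ∫⁻ g, linForm (u j * v) (normalize g) *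
            ∏ i ∈ s.erase j, linForm (u i) (normalize g) ∂gammaPi (a + Pi.single c 1)) := by
          rw [e1, Finset.mul_sum]
          refine Finset.sum_congr rfl fun c _ => ?_
          rw [mul_left_comm, ih' c]
      _ = linForm v a * (∑ c, u j₀ c * ENNReal.ofReal (a c) *
            ∫⁻ g, ∏ j ∈ s, linForm (u j) (normalize g) ∂gammaPi (a + Pi.single c 1)) +
          (∑ c, (u j₀ * v) c * ENNReal.ofReal (a c) *
            ∫⁻ g, ∏ j ∈ s, linForm (u j) (normalize g) ∂gammaPi (a + Pi.single c 1)) +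
          ∑ j ∈ s, ∑ c, u j₀ c * ENNReal.ofReal (a c) *
            ∫⁻ g, linForm (u j * v) (normalize g) *
              ∏ i ∈ s.erase j, linForm (u i) (normalize g) ∂gammaPi (a + Pi.single c 1) := by
          rw [Finset.sum_comm, Finset.mul_sum, ← Finset.sum_add_distrib, ← Finset.sum_add_distrib]
          refine Finset.sum_congr rfl fun c _ => ?_
          rw [← Finset.mul_sum, Pi.mul_apply]
          ring
      _ = _ := by
          rw [← e2, ← e3, mul_add, mul_add, Finset.mul_sum, add_assoc, mul_left_comm]
          congr 2
          refine Finset.sum_congr rfl fun j hjs => ?_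
          rw [← e4 j]
          congr 2
          ext g
          rw [herase j hjs, hins _ (hne j hjs)]
          ring

end Dirichlet

/-! ### Moments of the Dirichlet process -/

section DirichletProcess

variable {Ξ : Type*} [MeasurableSpace Ξ] {α : ℝ} {P : Measure Ξ} [IsProbabilityMeasure P]
  {Λ : Measure (ProbabilityMeasure Ξ)}

theorem measurable_probabilityMeasure_apply {A : Set Ξ} (hA : MeasurableSet A) :
    Measurable fun p : ProbabilityMeasure Ξ => (p : Measure Ξ) A :=
  (Measure.measurable_coe hA).comp measurable_subtype_coe

theorem measurable_probabilityMeasure_real {A : Set Ξ} (hA : MeasurableSet A) :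
    Measurable fun p : ProbabilityMeasure Ξ => (p : Measure Ξ).real A :=
  (measurable_probabilityMeasure_apply hA).ennreal_toReal

/-- The marginals of a Dirichlet process over a partition indexed by any finite type. -/
theorem IsDirichletProcess.map_partition {Ξ : Type*} [MeasurableSpace Ξ] {α : ℝ} {P : Measure Ξ}
    {Λ : Measure (ProbabilityMeasure Ξ)} (hα : 0 ≤ α) (hΛ : IsDirichletProcess α P Λ)
    {ι : Type*} [Fintype ι]
    {A : ι → Set Ξ} (hA : ∀ i, MeasurableSet (A i))
    (hd : Pairwise (fun i j => Disjoint (A i) (A j))) (hu : (⋃ i, A i) = Set.univ)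
    {F : (ι → ℝ) → ℝ≥0∞} (hF : Measurable F) :
    ∫⁻ p, F (fun i => (p : Measure Ξ).real (A i)) ∂Λ =
      ∫⁻ g, F (normalize g) ∂gammaPi fun i => α * P.real (A i) := by
  let e := (Fintype.equivFin ι).symm
  have hA' (i) : MeasurableSet (A (e i)) := hA _
  have hF' : Measurable fun x : Fin (Fintype.card ι) → ℝ => F (fun i => x (e.symm i)) :=
    hF.comp (by fun_prop)
  have h := hΛ _ (fun i => A (e i)) hA' (fun i j hij => hd (e.injective.ne hij))
    ((e.surjective.iUnion_comp A).trans hu)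
  have h1 := lintegral_map (μ := Λ) hF'
    (measurable_pi_lambda _ fun i => measurable_probabilityMeasure_real (hA' i))
  rw [h] at h1
  have h2 := lintegral_map (μ := gammaPi fun i => α * P.real (A (e i))) hF' measurable_normalize
  have h3 : dirichlet (fun i => α * P.real (A (e i))) =
      (gammaPi fun i => α * P.real (A (e i))).map normalize := rfl
  rw [h3, h2] at h1
  simp only [e.apply_symm_apply] at h1
  rw [← h1]
  have h4 : (gammaPi fun i => α * P.real (A (e i))).map (fun g i => g (e.symm i)) =
      gammaPi fun i => α * P.real (A i) := by
    have := fun i => isProbabilityMeasure_gammaLaw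
      (mul_nonneg hα (measureReal_nonneg (μ := P) (s := A i)))
    rw [gammaPi, gammaPi, ← Measure.pi_map_piCongrLeft e]
    congr 1
    ext g i
    obtain ⟨j, rfl⟩ := e.surjective i
    simp [MeasurableEquiv.coe_piCongrLeft, Equiv.piCongrLeft_apply_apply]
  have h5 : Measurable fun g : ι → ℝ => F (normalize g) := hF.comp measurable_normalize
  rw [← h4, lintegral_map h5 (by fun_prop)]
  refine lintegral_congr fun g => ?_
  congr 1
  ext i
  simp only [normalize]
  rw [e.symm.sum_comp]

/-- The Pólya urn identity for a Dirichlet process. -/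
theorem IsDirichletProcess.lintegral_mul_prod (hα : 0 < α) (hΛ : IsDirichletProcess α P Λ)
    {J : Type*} [DecidableEq J] [Fintype J] {A : Set Ξ} (hA : MeasurableSet A) {B : J → Set Ξ}
    (hB : ∀ j, MeasurableSet (B j)) :
    ENNReal.ofReal (α + Fintype.card J) *
        ∫⁻ p, (p : Measure Ξ) A * ∏ j, (p : Measure Ξ) (B j) ∂Λ =
      ENNReal.ofReal α * P A * ∫⁻ p, ∏ j, (p : Measure Ξ) (B j) ∂Λ +
        ∑ j, ∫⁻ p, (p : Measure Ξ) (B j ∩ A) *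
          ∏ i ∈ Finset.univ.erase j, (p : Measure Ξ) (B i) ∂Λ := by
  classical
  -- `none` stands for `A` and `some j` for `B j`. The sets `D σ` below are the atoms of the algebra
  -- they generate; some may be empty, which the shape-`0` convention allows.
  let C : Option J → Set Ξ := fun o => o.elim A B
  have hC (o) : MeasurableSet (C o) := by cases o <;> simp [C, hA, hB]
  let D : (Option J → Prop) → Set Ξ := fun σ => {x | ∀ o, x ∈ C o ↔ σ o}
  have hDeq (σ) : D σ = ⋂ o, if σ o then C o else (C o)ᶜ := by
    ext x
    simp only [D, Set.mem_ofPred_eq, Set.mem_iInter]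
    refine forall_congr' fun o => ?_
    split_ifs with h <;> simp [h]
  have hD (σ) : MeasurableSet (D σ) := by
    rw [hDeq]
    exact MeasurableSet.iInter fun o => by split_ifs; exacts [hC o, (hC o).compl]
  have hd : Pairwise (fun σ τ => Disjoint (D σ) (D τ)) := fun σ τ hne => by
    refine Set.disjoint_left.2 fun x h1 h2 => hne ?_
    ext o
    exact (h1 o).symm.trans (h2 o)
  have hu : (⋃ σ, D σ) = Set.univ :=
    Set.eq_univ_of_forall fun x => Set.mem_iUnion.2 ⟨fun o => x ∈ C o, fun o => Iff.rfl⟩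
  -- a set determined by membership in the `C o`
  have hrep (T : Set Ξ) (t : (Option J → Prop) → Prop)
      (ht : ∀ x, x ∈ T ↔ t (fun o => x ∈ C o)) (m : Measure Ξ) [IsFiniteMeasure m] :
      m T = linForm (fun σ => if t σ then 1 else 0) (fun σ => m.real (D σ)) := by
    have h1 : T = ⋃ σ ∈ Finset.univ.filter t, D σ := by
      ext x
      simp only [Finset.mem_filter, Finset.mem_univ, true_and, Set.mem_iUnion, exists_prop]
      rw [ht]
      constructor
      · exact fun h => ⟨_, h, fun o => Iff.rfl⟩
      · rintro ⟨σ, h, hx⟩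
        have : (fun o => x ∈ C o) = σ := by ext o; exact hx o
        rwa [this]
    rw [h1, measure_biUnion_finset (fun σ _ τ _ h => hd h) (fun σ _ => hD σ), linForm,
      Finset.sum_filter]
    refine Finset.sum_congr rfl fun σ _ => ?_
    split_ifs <;> simp
  let vA : (Option J → Prop) → ℝ≥0∞ := fun σ => if σ none then 1 else 0
  let uB : J → (Option J → Prop) → ℝ≥0∞ := fun j σ => if σ (some j) then 1 else 0
  have hrA (m : Measure Ξ) [IsFiniteMeasure m] : m A = linForm vA (fun σ => m.real (D σ)) :=
    hrep A (fun σ => σ none) (fun x => Iff.rfl) m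
  have hrB (j) (m : Measure Ξ) [IsFiniteMeasure m] :
      m (B j) = linForm (uB j) (fun σ => m.real (D σ)) :=
    hrep (B j) (fun σ => σ (some j)) (fun x => Iff.rfl) m
  have hrAB (j) (m : Measure Ξ) [IsFiniteMeasure m] :
      m (B j ∩ A) = linForm (uB j * vA) (fun σ => m.real (D σ)) := by
    rw [hrep (B j ∩ A) (fun σ => σ (some j) ∧ σ none) (fun x => Iff.rfl) m]
    congr 1
    ext σ
    simp only [uB, vA, Pi.mul_apply]
    split_ifs <;> simp_all
  have hl (w : (Option J → Prop) → ℝ≥0∞) : Measurable (linForm w) := measurable_linForm w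
  have hp (t : Finset J) : Measurable fun x => ∏ j ∈ t, linForm (uB j) x :=
    Finset.measurable_prod _ fun j _ => hl _
  have hsum : ∑ σ, α * P.real (D σ) = α := by
    rw [← Finset.mul_sum]
    have h1 := measureReal_biUnion_finset (μ := P) (s := Finset.univ) (f := D)
      (fun σ _ τ _ h => hd h) (fun σ _ => hD σ)
    simp only [Finset.mem_univ, Set.iUnion_true, hu, probReal_univ] at h1
    rw [← h1, mul_one]
  have key := lintegral_linForm_mul_prod vA uB Finset.univ
    (a := fun σ => α * P.real (D σ)) (fun σ => by positivity) (by rw [hsum]; exact hα)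
  -- The weights `α * P (D σ)` are the Dirichlet parameters, so the form evaluated at them is the
  -- prior term of the urn.
  have hPA : linForm vA (fun σ => α * P.real (D σ)) = ENNReal.ofReal α * P A := by
    rw [hrA P, linForm, linForm, Finset.mul_sum]
    refine Finset.sum_congr rfl fun σ _ => ?_
    rw [ENNReal.ofReal_mul hα.le]; ring
  rw [hsum, hPA] at key
  simp_rw [hrA, hrB, hrAB]
  rw [hrA P] at key
  have m1 : Measurable fun x => linForm vA x * ∏ j, linForm (uB j) x := (hl vA).mul (hp _)
  have m2 (j) : Measurable fun x =>
    linForm (uB j * vA) x * ∏ i ∈ Finset.univ.erase j, linForm (uB i) x := (hl _).mul (hp _)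
  rw [hΛ.map_partition hα.le hD hd hu m1, hΛ.map_partition hα.le hD hd hu (hp Finset.univ)]
  simp_rw [fun j => hΛ.map_partition hα.le hD hd hu (m2 j)]
  exact key

end DirichletProcess

/-! ### Mean measures and the total mass of a Dirichlet process -/

/-- The kernel that draws one point from a random probability measure. -/
def evalKernel (Ξ : Type*) [MeasurableSpace Ξ] : Kernel (ProbabilityMeasure Ξ) Ξ where
  toFun p := p
  measurable' := measurable_subtype_coe

instance (Ξ : Type*) [MeasurableSpace Ξ] : IsMarkovKernel (evalKernel Ξ) where
  isProbabilityMeasure p := inferInstanceAs (IsProbabilityMeasure (p : Measure Ξ))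

theorem evalKernel_comp_apply {Ξ : Type*} [MeasurableSpace Ξ] (q : Measure (ProbabilityMeasure Ξ))
    {A : Set Ξ} (hA : MeasurableSet A) :
    (evalKernel Ξ ∘ₘ q) A = ∫⁻ p, (p : Measure Ξ) A ∂q :=
  Measure.bind_apply hA (evalKernel Ξ).aemeasurable

section

variable {Ξ : Type*} [MeasurableSpace Ξ] {α : ℝ} {P : Measure Ξ} [IsProbabilityMeasure P]
  {Λ : Measure (ProbabilityMeasure Ξ)}

/-- The one-set partition suffices: its marginal is a Dirichlet law, of total mass `1`. -/
theorem IsDirichletProcess.isProbabilityMeasure (hα : 0 < α) (hΛ : IsDirichletProcess α P Λ) :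
    IsProbabilityMeasure Λ := by
  have h := hΛ.map_partition hα.le (ι := Unit) (A := fun _ => Set.univ) (fun _ => .univ)
    (fun i j h => (h (Subsingleton.elim i j)).elim) (Set.iUnion_const _) (F := fun _ => 1) measurable_const
  have := isProbabilityMeasure_gammaPi (a := fun _ : Unit => α * P.real Set.univ)
    (fun _ => by simpa using hα.le)
  simp only [lintegral_const, measure_univ, mul_one, one_mul] at h
  exact ⟨h⟩

/-- This is the urn identity with no observations. -/
theorem IsDirichletProcess.lintegral_apply (hα : 0 < α) (hΛ : IsDirichletProcess α P Λ)
    {A : Set Ξ} (hA : MeasurableSet A) : ∫⁻ p, (p : Measure Ξ) A ∂Λ = P A := by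
  have := hΛ.isProbabilityMeasure hα
  have h := hΛ.lintegral_mul_prod hα (J := Empty) hA (B := fun _ => ∅) (fun _ => .empty)
  simp only [Finset.univ_eq_empty, Finset.prod_empty, mul_one, lintegral_const, measure_univ,
    Finset.sum_empty, add_zero, Fintype.card_eq_zero, Nat.cast_zero] at h
  exact (ENNReal.mul_right_inj (by simpa using hα) ENNReal.ofReal_ne_top).1 h

end

/-! ### Boxes of samples -/

section Box

variable {Ξ : Type*} [MeasurableSpace Ξ] {S : ℕ} {N : Fin S → ℕ+}

/-- The set of samples with all observations in prescribed sets. -/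
def box {Ξ : Type*} {S : ℕ} {N : Fin S → ℕ+} (B : (l : Fin S) → Fin (N l : ℕ) → Set Ξ) : Set (Sample Ξ N) :=
  Set.univ.pi fun l => Set.univ.pi (B l)

theorem measurableSet_box {B : (l : Fin S) → Fin (N l : ℕ) → Set Ξ}
    (hB : ∀ l j, MeasurableSet (B l j)) : MeasurableSet (box B) :=
  MeasurableSet.univ_pi fun l => MeasurableSet.univ_pi (hB l)

/-- Products of boxes with measurable sets form a π-system that generates the product σ-algebra. On
them the model has explicit moments. -/
theorem ext_of_box_prod {m₁ m₂ : Measure (Sample Ξ N × Ξ)} [IsFiniteMeasure m₁]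
    (h : ∀ (B : (l : Fin S) → Fin (N l : ℕ) → Set Ξ) (A : Set Ξ), (∀ l j, MeasurableSet (B l j)) →
      MeasurableSet A → m₁ (box B ×ˢ A) = m₂ (box B ×ˢ A)) : m₁ = m₂ := by
  let C₁ (l : Fin S) : Set (Set (Fin (N l : ℕ) → Ξ)) :=
    Set.univ.pi '' Set.univ.pi fun _ => {s : Set Ξ | MeasurableSet s}
  let C : Set (Set (Sample Ξ N)) := Set.univ.pi '' Set.univ.pi C₁
  have hs₁ (l) : IsCountablySpanning (C₁ l) :=
    IsCountablySpanning.pi fun _ => isCountablySpanning_measurableSet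
  have hg : MeasurableSpace.generateFrom C = MeasurableSpace.pi :=
    generateFrom_eq_pi (fun l => generateFrom_pi) hs₁
  refine ext_of_generate_finite (Set.image2 (· ×ˢ ·) C {A : Set Ξ | MeasurableSet A})
    (generateFrom_eq_prod hg MeasurableSpace.generateFrom_measurableSet
      (IsCountablySpanning.pi hs₁) isCountablySpanning_measurableSet).symm
    (IsPiSystem.prod (IsPiSystem.pi fun l => isPiSystem_pi) MeasurableSpace.isPiSystem_measurableSet)
    ?_ ?_
  · rintro _ ⟨_, ⟨t, ht, rfl⟩, A, hA, rfl⟩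
    choose B hB hBt using fun l => ht l (Set.mem_univ l)
    obtain rfl : (fun l => Set.univ.pi (B l)) = t := funext hBt
    exact h B A (fun l j => hB l j (Set.mem_univ j)) hA
  · have := h (fun _ _ => Set.univ) Set.univ (fun _ _ => .univ) .univ
    simpa [box] using this

theorem sampleKernel_box (B : (l : Fin S) → Fin (N l : ℕ) → Set Ξ)
    (p : Fin S → ProbabilityMeasure Ξ) :
    sampleKernel Ξ N p (box B) = ∏ l, ∏ j, (p l : Measure Ξ) (B l j) := by
  change Measure.pi (fun l => Measure.pi fun _ : Fin (N l : ℕ) => (p l : Measure Ξ)) (box B) = _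
  rw [box, Measure.pi_pi]
  exact Finset.prod_congr rfl fun l _ => Measure.pi_pi _ _

instance : IsMarkovKernel (sampleKernel Ξ N) := by unfold sampleKernel; infer_instance

theorem marginalLaw_eq (prior : Measure (Fin S → ProbabilityMeasure Ξ)) [SFinite prior] :
    marginalLaw prior N = sampleKernel Ξ N ∘ₘ prior :=
  Measure.snd_compProd _ _

theorem marginalLaw_box (prior : Measure (Fin S → ProbabilityMeasure Ξ)) [SFinite prior]
    {B : (l : Fin S) → Fin (N l : ℕ) → Set Ξ} (hB : ∀ l j, MeasurableSet (B l j)) :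
    marginalLaw prior N (box B) = ∫⁻ p, ∏ l, ∏ j, (p l : Measure Ξ) (B l j) ∂prior := by
  rw [marginalLaw_eq, Measure.bind_apply (measurableSet_box hB) (Kernel.aemeasurable _)]
  simp_rw [sampleKernel_box]

/-- Conditional independence of the groups given the root measure. -/
theorem lintegral_bind_piKernel {A ι : Type*} {X : ι → Type*} [MeasurableSpace A] [Fintype ι]
    [∀ i, MeasurableSpace (X i)] (D : ∀ i, Kernel A (X i)) [∀ i, IsMarkovKernel (D i)]
    (Λ : Measure A) {f : ∀ i, X i → ℝ≥0∞} (hf : ∀ i, Measurable (f i)) :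
    ∫⁻ p, ∏ i, f i (p i) ∂(Λ.bind (piKernel D)) = ∫⁻ a, ∏ i, ∫⁻ q, f i q ∂D i a ∂Λ := by
  have hm : Measurable fun p : ∀ i, X i => ∏ i, f i (p i) :=
    Finset.measurable_prod _ fun i _ => (hf i).comp (measurable_pi_apply i)
  rw [Measure.lintegral_bind (Kernel.aemeasurable _) hm.aemeasurable]
  exact lintegral_congr fun a => lintegral_pi_prod (fun i => D i a) hf

end Box

/-! ### The posterior mean of a group -/

section PosteriorMean

/-- Multiplication of a kernel by a constant. -/
def constSMul {X Y : Type*} [MeasurableSpace X] [MeasurableSpace Y] (c : ℝ≥0∞)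
    (κ : Kernel X Y) : Kernel X Y where
  toFun x := c • κ x
  measurable' := Measure.measurable_of_measurable_coe _ fun s hs => by
    simpa using (κ.measurable_coe hs).const_mul c

theorem constSMul_apply {X Y : Type*} [MeasurableSpace X] [MeasurableSpace Y] (c : ℝ≥0∞)
    (κ : Kernel X Y) (x : X) : constSMul c κ x = c • κ x := rfl

theorem isFiniteKernel_constSMul {X Y : Type*} [MeasurableSpace X] [MeasurableSpace Y] {c : ℝ≥0∞}
    (hc : c ≠ ⊤) (κ : Kernel X Y) [IsMarkovKernel κ] : IsFiniteKernel (constSMul c κ) :=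
  ⟨c, hc.lt_top, fun x => by simp [constSMul_apply]⟩

variable {Ξ : Type*} [MeasurableSpace Ξ] {S : ℕ} {N : Fin S → ℕ+}

/-- The counting kernel of the observations of group `s`. -/
def countKernel (Ξ : Type*) [MeasurableSpace Ξ] {S : ℕ} (N : Fin S → ℕ+) (s : Fin S) :
    Kernel (Sample Ξ N) Ξ where
  toFun x := ∑ j, Measure.dirac (x s j)
  measurable' := Measure.measurable_of_measurable_coe _ fun A hA => by
    simp only [Measure.coe_finsetSum, Finset.sum_apply]
    refine Finset.measurable_sum _ fun j _ => ?_
    exact (Measure.measurable_coe hA).comp (Measure.measurable_dirac.comp (by fun_prop))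

theorem countKernel_apply (s : Fin S) (x : Sample Ξ N) :
    countKernel Ξ N s x = ∑ j, Measure.dirac (x s j) := rfl

instance (s : Fin S) : IsFiniteKernel (countKernel Ξ N s) :=
  ⟨(N s : ℕ), by simp, fun x => by simp [countKernel_apply]⟩

/-- Requiring one observation to lie in `A` gives a box again, so the counting kernel is computed
from box probabilities alone. -/
theorem box_update_inter {Ξ : Type*} {S : ℕ} {N : Fin S → ℕ+} (B : (l : Fin S) → Fin (N l : ℕ) → Set Ξ)
    (s : Fin S) (j : Fin (N s : ℕ)) (A : Set Ξ) :
    box (Function.update B s (Function.update (B s) j (B s j ∩ A))) =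
      box B ∩ {x | x s j ∈ A} := by
  ext x
  simp only [box, Set.mem_pi, Set.mem_univ, true_implies, Set.mem_inter_iff, Set.mem_ofPred_eq]
  constructor
  · intro h
    have hs := h s
    rw [Function.update_self] at hs
    refine ⟨fun l i => ?_, ?_⟩
    · by_cases hl : l = s
      · subst hl
        by_cases hi : i = j
        · subst hi; have := hs i; rw [Function.update_self] at this; exact this.1
        · have := hs i; rwa [Function.update_of_ne hi] at this
      · have := h l i; rwa [Function.update_of_ne hl] at this
    · have := hs j; rw [Function.update_self] at this; exact this.2
  · rintro ⟨h, hA⟩ l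
    by_cases hl : l = s
    · subst hl
      rw [Function.update_self]
      intro i
      by_cases hi : i = j
      · subst hi; rw [Function.update_self]; exact ⟨h _ _, hA⟩
      · rw [Function.update_of_ne hi]; exact h _ _
    · rw [Function.update_of_ne hl]; exact h l

/-- Under a hierarchical model whose groups are Dirichlet processes given `p₀`, the posterior
mean of `p_s` dominates the counting measure of the observations of group `s`, up to the factor
`α_s + N_s`. -/
theorem sum_dirac_le_posterior_mean [StandardBorelSpace Ξ] [Nonempty Ξ] {α : Fin S → ℝ}
    (hα : ∀ s, 0 < α s) {Λ : Measure (ProbabilityMeasure Ξ)} [IsProbabilityMeasure Λ]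
    {D : Fin S → Kernel (ProbabilityMeasure Ξ) (ProbabilityMeasure Ξ)} [∀ s, IsMarkovKernel (D s)]
    (hD : ∀ s (p₀ : ProbabilityMeasure Ξ), IsDirichletProcess (α s) (p₀ : Measure Ξ) (D s p₀))
    {s : Fin S} {κ : Kernel (Sample Ξ N) (ProbabilityMeasure Ξ)}
    (hκ : IsPosterior (Λ.bind (piKernel D)) N s κ) :
    ∀ᵐ x ∂marginalLaw (Λ.bind (piKernel D)) N,
      ∑ j, Measure.dirac (x s j) ≤
        ENNReal.ofReal (α s + (N s : ℕ)) • (evalKernel Ξ ∘ₘ κ x) := by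
  obtain ⟨_, hκ⟩ := hκ
  set prior := Λ.bind (piKernel D) with hprior
  have : IsProbabilityMeasure prior := by rw [hprior]; infer_instance
  have : IsProbabilityMeasure (marginalLaw prior N) := by rw [marginalLaw_eq]; infer_instance
  set c := ENNReal.ofReal (α s + (N s : ℕ)) with hc
  -- the joint law of the sample and of a draw from `p₀`
  let ρ : Measure (Sample Ξ N × Ξ) := ((sampleKernel Ξ N ∘ₖ piKernel D) ×ₖ evalKernel Ξ) ∘ₘ Λ
  have : IsProbabilityMeasure ρ := by unfold ρ; infer_instance
  -- the moments of the groups given `p₀`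
  let M (l : Fin S) (b : Fin (N l : ℕ) → Set Ξ) (p₀ : ProbabilityMeasure Ξ) : ℝ≥0∞ :=
    ∫⁻ q, ∏ j, (q : Measure Ξ) (b j) ∂D l p₀
  have hpm (l) {b : Fin (N l : ℕ) → Set Ξ} (hb : ∀ j, MeasurableSet (b j)) (t : Finset _) :
      Measurable fun q : ProbabilityMeasure Ξ => ∏ j ∈ t, (q : Measure Ξ) (b j) :=
    Finset.measurable_prod _ fun j _ => measurable_probabilityMeasure_apply (hb j)
  have hM (l) {b : Fin (N l : ℕ) → Set Ξ} (hb : ∀ j, MeasurableSet (b j)) : Measurable (M l b) :=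
    (hpm l hb _).lintegral_kernel
  have hcond {B : (l : Fin S) → Fin (N l : ℕ) → Set Ξ} (hB : ∀ l j, MeasurableSet (B l j)) (p₀) :
      (sampleKernel Ξ N ∘ₖ piKernel D) p₀ (box B) = ∏ l, M l (B l) p₀ := by
    rw [Kernel.comp_apply' _ _ _ (measurableSet_box hB)]
    simp_rw [sampleKernel_box]
    exact lintegral_pi_prod (fun l => D l p₀) fun l => hpm l (hB l) _
  have hmarg {B : (l : Fin S) → Fin (N l : ℕ) → Set Ξ} (hB : ∀ l j, MeasurableSet (B l j)) :
      marginalLaw prior N (box B) = ∫⁻ p₀, ∏ l, M l (B l) p₀ ∂Λ := by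
    rw [marginalLaw_box _ hB, lintegral_bind_piKernel D Λ fun l => hpm l (hB l) _]
  have hρ {B : (l : Fin S) → Fin (N l : ℕ) → Set Ξ} (hB : ∀ l j, MeasurableSet (B l j))
      {A : Set Ξ} (hA : MeasurableSet A) :
      ρ (box B ×ˢ A) = ∫⁻ p₀, (∏ l, M l (B l) p₀) * (p₀ : Measure Ξ) A ∂Λ := by
    rw [Measure.bind_apply ((measurableSet_box hB).prod hA) (Kernel.aemeasurable _)]
    refine lintegral_congr fun p₀ => ?_
    rw [Kernel.prod_apply, Measure.prod_prod, hcond hB]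
    rfl
  have hfst : ρ.fst = marginalLaw prior N := by
    rw [Measure.fst, Measure.map_comp _ _ measurable_fst, ← Kernel.fst_eq, Kernel.fst_prod,
      marginalLaw_eq, hprior, Measure.comp_assoc]
  have hmean {B : (l : Fin S) → Fin (N l : ℕ) → Set Ξ} (hB : ∀ l j, MeasurableSet (B l j))
      {A : Set Ξ} (hA : MeasurableSet A) :
      (marginalLaw prior N ⊗ₘ (evalKernel Ξ ∘ₖ κ)) (box B ×ˢ A) =
        ∫⁻ p₀, (∫⁻ q, (q : Measure Ξ) A * ∏ j, (q : Measure Ξ) (B s j) ∂D s p₀) *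
          ∏ l ∈ Finset.univ.erase s, M l (B l) p₀ ∂Λ := by
    have hA' := measurable_probabilityMeasure_apply hA
    have hbox := measurableSet_box hB
    have hz : Measurable fun z : Sample Ξ N × ProbabilityMeasure Ξ => (z.2 : Measure Ξ) A :=
      hA'.comp measurable_snd
    have hz' : Measurable fun z : (Fin S → ProbabilityMeasure Ξ) × Sample Ξ N =>
        (z.1 s : Measure Ξ) A := hA'.comp ((measurable_pi_apply s).comp measurable_fst)
    have hpre : (fun z : (Fin S → ProbabilityMeasure Ξ) × Sample Ξ N => (z.2, z.1 s)) ⁻¹'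
        (box B ×ˢ Set.univ) = Set.univ ×ˢ box B := by ext z; simp
    have h1 : (marginalLaw prior N ⊗ₘ (evalKernel Ξ ∘ₖ κ)) (box B ×ˢ A) =
        ∫⁻ p, (p s : Measure Ξ) A * ∏ l, ∏ j, (p l : Measure Ξ) (B l j) ∂prior := by
      calc _ = ∫⁻ x in box B, ∫⁻ q in Set.univ, (q : Measure Ξ) A ∂κ x ∂marginalLaw prior N := by
            rw [Measure.compProd_apply_prod hbox hA]
            refine setLIntegral_congr_fun hbox fun x _ => ?_
            rw [Kernel.comp_apply' _ _ _ hA, Measure.restrict_univ]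
            rfl
        _ = ∫⁻ z in box B ×ˢ Set.univ, (z.2 : Measure Ξ) A ∂(marginalLaw prior N ⊗ₘ κ) :=
            (Measure.setLIntegral_compProd hz hbox .univ).symm
        _ = ∫⁻ z in Set.univ ×ˢ box B, (z.1 s : Measure Ξ) A ∂jointLaw prior N := by
            rw [hκ, setLIntegral_map (hbox.prod .univ) hz (by fun_prop), hpre]
        _ = _ := by
            rw [jointLaw, Measure.setLIntegral_compProd hz' .univ hbox, Measure.restrict_univ]
            refine lintegral_congr fun p => ?_
            change ∫⁻ _ in box B, (p s : Measure Ξ) A ∂sampleKernel Ξ N p = _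
            rw [setLIntegral_const, sampleKernel_box]
    -- The factor `p_s(A)` is absorbed into group `s`, so that the integrand is a product over
    -- groups.
    have h2 (p : Fin S → ProbabilityMeasure Ξ) :
        (p s : Measure Ξ) A * ∏ l, ∏ j, (p l : Measure Ξ) (B l j) =
          ∏ l, (if l = s then (p l : Measure Ξ) A else 1) * ∏ j, (p l : Measure Ξ) (B l j) := by
      rw [Finset.prod_mul_distrib]
      simp
    have h3 (l) : Measurable fun q : ProbabilityMeasure Ξ =>
        (if l = s then (q : Measure Ξ) A else 1) * ∏ j, (q : Measure Ξ) (B l j) := by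
      refine Measurable.mul ?_ (hpm l (hB l) _)
      split_ifs
      exacts [hA', measurable_const]
    simp_rw [h1, h2]
    rw [lintegral_bind_piKernel D Λ h3]
    refine lintegral_congr fun p₀ => ?_
    rw [← Finset.mul_prod_erase Finset.univ _ (Finset.mem_univ s)]
    congr 1
    · simp
    · refine Finset.prod_congr rfl fun l hl => ?_
      simp [M, Finset.ne_of_mem_erase hl]
  have hcount {B : (l : Fin S) → Fin (N l : ℕ) → Set Ξ} (hB : ∀ l j, MeasurableSet (B l j))
      {A : Set Ξ} (hA : MeasurableSet A) :
      (marginalLaw prior N ⊗ₘ countKernel Ξ N s) (box B ×ˢ A) =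
        ∫⁻ p₀, (∑ j, ∫⁻ q, (q : Measure Ξ) (B s j ∩ A) *
            ∏ i ∈ Finset.univ.erase j, (q : Measure Ξ) (B s i) ∂D s p₀) *
          ∏ l ∈ Finset.univ.erase s, M l (B l) p₀ ∂Λ := by
    have hbox := measurableSet_box hB
    let B' (j) := Function.update B s (Function.update (B s) j (B s j ∩ A))
    have hB' (j l i) : MeasurableSet (B' j l i) := by
      by_cases hl : l = s
      · subst hl
        simp only [B', Function.update_self]
        by_cases hi : i = j
        · subst hi; rw [Function.update_self]; exact (hB _ _).inter hA
        · rw [Function.update_of_ne hi]; exact hB _ _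
      · simp only [B', Function.update_of_ne hl]; exact hB _ _
    have hA'' (j) : MeasurableSet {x : Sample Ξ N | x s j ∈ A} :=
      hA.preimage (f := fun x : Sample Ξ N => x s j) (by fun_prop)
    have h1 : (marginalLaw prior N ⊗ₘ countKernel Ξ N s) (box B ×ˢ A) =
        ∑ j, marginalLaw prior N (box (B' j)) := by
      rw [Measure.compProd_apply_prod hbox hA]
      simp only [countKernel_apply, Measure.coe_finsetSum, Finset.sum_apply,
        Measure.dirac_apply' _ hA]
      have hm (j) : Measurable fun x : Sample Ξ N => A.indicator (1 : Ξ → ℝ≥0∞) (x s j) :=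
        (measurable_one.indicator hA).comp (by fun_prop)
      rw [lintegral_finsetSum _ fun j _ => hm j]
      refine Finset.sum_congr rfl fun j _ => ?_
      have h2 : (fun x : Sample Ξ N => A.indicator (1 : Ξ → ℝ≥0∞) (x s j)) =
          {x : Sample Ξ N | x s j ∈ A}.indicator 1 := rfl
      rw [h2, lintegral_indicator_one (hA'' j), Measure.restrict_apply (hA'' j), Set.inter_comm,
        box_update_inter]
    have hMm (j) : Measurable fun p₀ => ∏ l, M l (B' j l) p₀ :=
      Finset.measurable_prod _ fun l _ => hM l (hB' j l)
    rw [h1, Finset.sum_congr rfl fun j _ => hmarg (hB' j),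
      ← lintegral_finsetSum _ fun j _ => hMm j]
    refine lintegral_congr fun p₀ => ?_
    rw [Finset.sum_mul]
    refine Finset.sum_congr rfl fun j _ => ?_
    rw [← Finset.mul_prod_erase Finset.univ _ (Finset.mem_univ s)]
    congr 1
    · refine lintegral_congr fun q => ?_
      rw [← Finset.mul_prod_erase Finset.univ _ (Finset.mem_univ j)]
      simp only [B', Function.update_self]
      congr 1
      refine Finset.prod_congr rfl fun i hi => ?_
      rw [Function.update_of_ne (Finset.ne_of_mem_erase hi)]
    · refine Finset.prod_congr rfl fun l hl => ?_
      simp only [B', Function.update_of_ne (Finset.ne_of_mem_erase hl)]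
  have hc' : c ≠ ⊤ := ENNReal.ofReal_ne_top
  have := isFiniteKernel_constSMul hc' (evalKernel Ξ ∘ₖ κ)
  have := isFiniteKernel_constSMul (ENNReal.ofReal_ne_top (r := α s)) ρ.condKernel
  -- The urn identity after averaging over `p₀`: the scaled posterior mean of `p_s` is `α s` times
  -- that of `p₀` plus the counting measure. It is tested on boxes, where the other groups enter
  -- only as a common factor for fixed `p₀`.
  have key : marginalLaw prior N ⊗ₘ constSMul c (evalKernel Ξ ∘ₖ κ) =
      marginalLaw prior N ⊗ₘ (constSMul (ENNReal.ofReal (α s)) ρ.condKernel +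
        countKernel Ξ N s) := by
    have hsmul (e : ℝ≥0∞) (η : Kernel (Sample Ξ N) Ξ) [IsMarkovKernel η]
        [IsFiniteKernel (constSMul e η)] :
        marginalLaw prior N ⊗ₘ constSMul e η = e • (marginalLaw prior N ⊗ₘ η) := by
      ext t ht
      rw [Measure.smul_apply, Measure.compProd_apply ht, Measure.compProd_apply ht, smul_eq_mul,
        ← lintegral_const_mul _ (Kernel.measurable_kernel_prodMk_left ht)]
      rfl
    have hdis : marginalLaw prior N ⊗ₘ ρ.condKernel = ρ := by
      rw [← hfst]; exact ρ.disintegrate _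
    refine ext_of_box_prod fun B A hB hA => ?_
    rw [Measure.compProd_add_right, hsmul, hsmul, hdis,
      Measure.add_apply, Measure.smul_apply, Measure.smul_apply, smul_eq_mul, smul_eq_mul,
      hmean hB hA, hρ hB hA, hcount hB hA]
    have hW : Measurable fun p₀ => ∏ l ∈ Finset.univ.erase s, M l (B l) p₀ :=
      Finset.measurable_prod _ fun l _ => hM l (hB l)
    have hW' : Measurable fun p₀ => ∏ l, M l (B l) p₀ :=
      Finset.measurable_prod _ fun l _ => hM l (hB l)
    have hA' := measurable_probabilityMeasure_apply hA
    have hq : Measurable fun p₀ => ∫⁻ q : ProbabilityMeasure Ξ,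
        (q : Measure Ξ) A * ∏ j, (q : Measure Ξ) (B s j) ∂D s p₀ :=
      (hA'.mul (hpm s (hB s) _)).lintegral_kernel
    have hqW : Measurable fun p₀ => (∫⁻ q : ProbabilityMeasure Ξ,
        (q : Measure Ξ) A * ∏ j, (q : Measure Ξ) (B s j) ∂D s p₀) *
        ∏ l ∈ Finset.univ.erase s, M l (B l) p₀ := hq.mul hW
    have hWA : Measurable fun p₀ : ProbabilityMeasure Ξ =>
        (∏ l, M l (B l) p₀) * (p₀ : Measure Ξ) A := hW'.mul hA'
    rw [← lintegral_const_mul _ hqW, ← lintegral_const_mul _ hWA,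
      ← lintegral_add_left (hWA.const_mul _)]
    refine lintegral_congr fun p₀ => ?_
    have h := (hD s p₀).lintegral_mul_prod (hα s) hA (hB s)
    rw [Fintype.card_fin] at h
    rw [← mul_assoc, h, add_mul, ← Finset.mul_prod_erase Finset.univ (fun l => M l (B l) p₀)
      (Finset.mem_univ s)]
    congr 1
    simp only [M]
    ring
  filter_upwards [Kernel.ae_eq_of_compProd_eq key] with x hx
  have h1 : c • (evalKernel Ξ ∘ₘ κ x) =
      ENNReal.ofReal (α s) • ρ.condKernel x + ∑ j, Measure.dirac (x s j) := by
    simpa [constSMul_apply, Kernel.comp_apply, countKernel_apply] using hx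
  rw [h1]
  exact Measure.le_add_left le_rfl

end PosteriorMean

/-! ### The tie-free version of the posterior -/

section TwoStage

variable {Ξ : Type*} [MeasurableSpace Ξ]

theorem empirical_apply_univ {ι : Type*} [Fintype ι] [Nonempty ι] (x : ι → Ξ) :
    empirical x Set.univ = 1 := by
  simp only [empirical, Measure.smul_apply, Measure.coe_finsetSum, Finset.sum_apply, measure_univ,
    smul_eq_mul, Finset.sum_const, Finset.card_univ, nsmul_eq_mul, mul_one]
  exact ENNReal.inv_mul_cancel (by simp) (by simp)

theorem isProbabilityMeasure_updatedCenter {ι : Type*} [Fintype ι] [Nonempty ι] {α : ℝ}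
    (hα : 0 < α) (P : Measure Ξ) [IsProbabilityMeasure P] (x : ι → Ξ) :
    IsProbabilityMeasure (updatedCenter α P x) := by
  constructor
  have hpos : (0 : ℝ) < α + Fintype.card ι := by positivity
  rw [updatedCenter, Measure.add_apply, Measure.smul_apply, Measure.smul_apply,
    empirical_apply_univ, measure_univ, smul_eq_mul, smul_eq_mul, mul_one, mul_one,
    ← ENNReal.ofReal_add (by positivity) (by positivity), ← add_div, add_comm, div_self hpos.ne',
    ENNReal.ofReal_one]

/-- Given `p₀`, the mean of the inner process is its center, which contains the weighted group
empirical measure whatever `p₀` is. Of the outer law only its total mass matters. -/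
theorem IsTwoStageLaw.sum_dirac_le {S : ℕ} {N : Fin S → ℕ+} {α₀ : ℝ} (hα₀ : 0 < α₀)
    {α : Fin S → ℝ} {s : Fin S} (hα : 0 < α s) {H : Measure Ξ} [IsProbabilityMeasure H]
    {x : Sample Ξ N} {q : Measure (ProbabilityMeasure Ξ)} (hq : IsTwoStageLaw α₀ α H s x q) :
    ∑ j, Measure.dirac (x s j) ≤ ENNReal.ofReal (α s + (N s : ℕ)) • (evalKernel Ξ ∘ₘ q) := by
  obtain ⟨Λ, D, hΛ, hD, rfl⟩ := hq
  have : Nonempty (Fin (N s : ℕ)) := ⟨⟨0, (N s).pos⟩⟩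
  have : Nonempty ((l : Fin S) × Fin (N l : ℕ)) := ⟨⟨s, Classical.arbitrary _⟩⟩
  have := isProbabilityMeasure_updatedCenter hα₀ H
    fun i : (l : Fin S) × Fin (N l : ℕ) => x i.1 i.2
  have hΛ1 : IsProbabilityMeasure Λ := hΛ.isProbabilityMeasure (by positivity)
  have hpos : 0 < α s + (N s : ℕ) := by positivity
  have hN : ((N s : ℕ) : ℝ≥0∞) ≠ 0 := by simp
  refine Measure.le_iff.2 fun A hA => ?_
  have hmean : (evalKernel Ξ ∘ₘ Λ.bind D) A =
      ∫⁻ p₀ : ProbabilityMeasure Ξ, updatedCenter (α s) (p₀ : Measure Ξ) (x s) A ∂Λ := by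
    rw [evalKernel_comp_apply _ hA, Measure.lintegral_bind D.aemeasurable
      (measurable_probabilityMeasure_apply hA).aemeasurable]
    refine lintegral_congr fun p₀ => ?_
    have := isProbabilityMeasure_updatedCenter hα (p₀ : Measure Ξ) (x s)
    exact (hD p₀).lintegral_apply hpos hA
  rw [Measure.smul_apply, hmean, smul_eq_mul]
  calc (∑ j, Measure.dirac (x s j)) A
      = ENNReal.ofReal (α s + (N s : ℕ)) *
          (ENNReal.ofReal ((N s : ℕ) / (α s + (N s : ℕ))) * empirical (x s) A) := by
        rw [← mul_assoc, ← ENNReal.ofReal_mul hpos.le, mul_div_cancel₀ _ hpos.ne',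
          ENNReal.ofReal_natCast, empirical, Measure.smul_apply, smul_eq_mul, ← mul_assoc,
          Fintype.card_fin, ENNReal.mul_inv_cancel hN (by simp), one_mul]
    _ = ENNReal.ofReal (α s + (N s : ℕ)) * ∫⁻ _ : ProbabilityMeasure Ξ,
          ENNReal.ofReal ((N s : ℕ) / (α s + (N s : ℕ))) * empirical (x s) A ∂Λ := by simp
    _ ≤ _ := by
        gcongr with p₀
        rw [updatedCenter, Measure.add_apply, Measure.smul_apply, Fintype.card_fin]
        exact le_self_add

end TwoStage

/-! ### Ties -/

/-- By Fubini: the fibres of the diagonal are single points, which are null for `P'`. -/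
theorem ae_ne_of_indepFun {Ξ Ω : Type*} [TopologicalSpace Ξ] [PolishSpace Ξ] [MeasurableSpace Ξ]
    [BorelSpace Ξ] [MeasurableSpace Ω] {μ : Measure Ω} [IsProbabilityMeasure μ] {X Y : Ω → Ξ}
    {P P' : Measure Ξ} [IsProbabilityMeasure P] [IsProbabilityMeasure P'] [NullSingletonClass P']
    (hX : HasLaw X P μ) (hY : HasLaw Y P' μ) (hXY : IndepFun X Y μ) :
    ∀ᵐ ω ∂μ, X ω ≠ Y ω := by
  have h := (indepFun_iff_map_prod_eq_prod_map_map hX.aemeasurable hY.aemeasurable).1 hXY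
  rw [hX.map_eq, hY.map_eq] at h
  have hd : MeasurableSet (Set.diagonal Ξ) := measurableSet_diagonal
  have h0 : (P.prod P') (Set.diagonal Ξ) = 0 := by
    rw [Measure.measure_prod_null hd]
    refine ae_of_all _ fun x => ?_
    have : Prod.mk x ⁻¹' Set.diagonal Ξ = {x} := by ext y; simp [eq_comm]
    simp [this]
  have h1 : ∀ᵐ z ∂μ.map (fun ω => (X ω, Y ω)), z ∉ Set.diagonal Ξ := by
    rw [h]; exact measure_eq_zero_iff_ae_notMem.1 h0
  exact ae_of_ae_map (hX.aemeasurable.prodMk hY.aemeasurable) h1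

/-! ### Bounds for the criterion -/

section Criterion

variable {Θ Ξ : Type*} [MeasurableSpace Ξ] {h : Θ → Ξ → ℝ} {K : ℝ}

theorem integrable_loss (hmeas : ∀ θ, Measurable (h θ)) (hK : ∀ θ x, h θ x ∈ Set.Icc 0 K) (θ : Θ)
    (P : Measure Ξ) [IsFiniteMeasure P] : Integrable (h θ) P :=
  Integrable.of_bound (hmeas θ).aestronglyMeasurable K
    (ae_of_all _ fun x => by rw [Real.norm_eq_abs, abs_of_nonneg (hK θ x).1]; exact (hK θ x).2)

theorem risk_mem_Icc (hmeas : ∀ θ, Measurable (h θ)) (hK : ∀ θ x, h θ x ∈ Set.Icc 0 K) (θ : Θ)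
    (P : Measure Ξ) [IsProbabilityMeasure P] : risk h P θ ∈ Set.Icc 0 K := by
  refine ⟨integral_nonneg fun x => (hK θ x).1, ?_⟩
  have := integral_mono (integrable_loss hmeas hK θ P) (integrable_const K) fun x => (hK θ x).2
  simpa [risk] using this

theorem measurable_risk (hmeas : ∀ θ, Measurable (h θ)) (θ : Θ) :
    Measurable fun p : ProbabilityMeasure Ξ => risk h (p : Measure Ξ) θ :=
  ((hmeas θ).stronglyMeasurable.integral_kernel (κ := evalKernel Ξ)).measurable

theorem risk_empirical {n : ℕ} (x : Fin n → Ξ) (hmeas : ∀ θ, Measurable (h θ)) (θ : Θ) :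
    risk h (empirical x) θ = (n : ℝ)⁻¹ * ∑ j, h θ (x j) := by
  rw [risk, empirical, integral_smul_measure, integral_finsetSum_measure]
  · simp [integral_dirac' _ _ (hmeas θ).stronglyMeasurable]
  · intro j _
    exact integrable_dirac' (hmeas θ).stronglyMeasurable (by simp)

/-- The domination is integrated against `h θ` and against `K - h θ`; the first gives the lower
bound, the second the upper one. -/
theorem abs_integral_risk_sub_le (hmeas : ∀ θ, Measurable (h θ))
    (hK : ∀ θ x, h θ x ∈ Set.Icc 0 K) {q : Measure (ProbabilityMeasure Ξ)}
    [IsProbabilityMeasure q] {α : ℝ} (hα : 0 < α) {n : ℕ} (hn : 0 < n) {x : Fin n → Ξ}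
    (hq : ∑ j, Measure.dirac (x j) ≤ ENNReal.ofReal (α + n) • (evalKernel Ξ ∘ₘ q)) (θ : Θ) :
    |∫ p, risk h (p : Measure Ξ) θ ∂q - risk h (empirical x) θ| ≤ α * K / (α + n) := by
  have hpos : 0 < α + n := by positivity
  have hn' : (0 : ℝ) < n := by exact_mod_cast hn
  set m := evalKernel Ξ ∘ₘ q with hm
  have hint : ∫ p, risk h (p : Measure Ξ) θ ∂q = risk h m θ := by
    have hi := integrable_loss hmeas hK θ m
    rw [hm, Measure.comp_eq_comp_const_apply] at hi
    rw [risk, hm, Measure.comp_eq_comp_const_apply, Kernel.integral_comp hi]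
    rfl
  have hsum (f : Ξ → ℝ) (hf : Measurable f) (hf0 : ∀ y, 0 ≤ f y) (hfi : Integrable f m) :
      ∑ j, f (x j) ≤ (α + n) * ∫ y, f y ∂m := by
    have h1 := integral_mono_measure hq (ae_of_all _ hf0)
      (hfi.smul_measure ENNReal.ofReal_ne_top)
    rw [integral_smul_measure, ENNReal.toReal_ofReal hpos.le, integral_finsetSum_measure] at h1
    · simpa [integral_dirac' _ _ hf.stronglyMeasurable] using h1
    · intro j _
      exact integrable_dirac' hf.stronglyMeasurable (by simp)
  have hi := integrable_loss hmeas hK θ m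
  have h1 := hsum (h θ) (hmeas θ) (fun y => (hK θ y).1) hi
  have h2 := hsum (fun y => K - h θ y) (by have := hmeas θ; fun_prop)
    (fun y => sub_nonneg.2 (hK θ y).2) ((integrable_const K).sub hi)
  rw [integral_sub (integrable_const K) hi] at h2
  simp only [Finset.sum_sub_distrib, Finset.sum_const, Finset.card_univ, Fintype.card_fin,
    nsmul_eq_mul, integral_const, probReal_univ, one_smul] at h2
  have he := risk_empirical x hmeas θ
  have hes : ∑ j, h θ (x j) = n * risk h (empirical x) θ := by rw [he]; field_simp
  have hm' : ∫ y, h θ y ∂m = risk h m θ := rfl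
  rw [hes, hm'] at h1 h2
  have hE0 : 0 ≤ risk h (empirical x) θ := by
    rw [he]; exact mul_nonneg (by positivity) (Finset.sum_nonneg fun j _ => (hK θ _).1)
  have hEK : risk h (empirical x) θ ≤ K := by
    have : ∑ j, h θ (x j) ≤ ∑ _j : Fin n, K := Finset.sum_le_sum fun j _ => (hK θ _).2
    simp only [Finset.sum_const, Finset.card_univ, Fintype.card_fin, nsmul_eq_mul, hes] at this
    exact le_of_mul_le_mul_left this hn'
  rw [hint, abs_le, neg_le, le_div_iff₀ hpos, le_div_iff₀ hpos]
  have h3 := mul_le_mul_of_nonneg_left hEK hα.le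
  have h4 := mul_nonneg hα.le hE0
  constructor <;> linarith

theorem abs_criterion_sub_le (hmeas : ∀ θ, Measurable (h θ))
    (hK : ∀ θ x, h θ x ∈ Set.Icc 0 K) {q : Measure (ProbabilityMeasure Ξ)}
    [IsProbabilityMeasure q] {φ : ℝ → ℝ} (hφ : MonotoneOn φ (Set.Icc 0 K)) {ε : ℝ}
    (hε : ∀ t ∈ Set.Icc 0 K, |φ t - t| ≤ ε) (θ : Θ) :
    |criterion h φ q θ - ∫ p, risk h (p : Measure Ξ) θ ∂q| ≤ ε := by
  have hr (p : ProbabilityMeasure Ξ) := risk_mem_Icc hmeas hK θ (p : Measure Ξ)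
  have hrm := measurable_risk hmeas θ
  have hri : Integrable (fun p : ProbabilityMeasure Ξ => risk h (p : Measure Ξ) θ) q :=
    Integrable.of_bound hrm.aestronglyMeasurable K
      (ae_of_all _ fun p => by rw [Real.norm_eq_abs, abs_of_nonneg (hr p).1]; exact (hr p).2)
  have hφm : Measurable fun p : ProbabilityMeasure Ξ => φ (risk h (p : Measure Ξ) θ) := by
    obtain ⟨p⟩ : Nonempty (ProbabilityMeasure Ξ) := by
      by_contra hne
      rw [not_nonempty_iff] at hne
      exact IsProbabilityMeasure.ne_zero q (Measure.eq_zero_of_isEmpty q)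
    have hK0 : 0 ≤ K := (hr p).1.trans (hr p).2
    -- Monotonicity is known only on `[0, K]`; clamping the argument gives a function monotone on
    -- the whole line, hence measurable, with the same values at risks.
    have hmono : Monotone fun t => φ (Set.projIcc 0 K hK0 t) := fun a b hab =>
      hφ (Subtype.coe_prop _) (Subtype.coe_prop _) (Set.monotone_projIcc hK0 hab)
    have heq : (fun p : ProbabilityMeasure Ξ => φ (risk h (p : Measure Ξ) θ)) =
        fun p : ProbabilityMeasure Ξ => φ (Set.projIcc 0 K hK0 (risk h (p : Measure Ξ) θ)) := by
      ext p
      simp [Set.projIcc_of_mem hK0 (hr p)]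
    rw [heq]
    exact hmono.measurable.comp hrm
  have hbd (p : ProbabilityMeasure Ξ) := hε _ (hr p)
  have hφi : Integrable (fun p : ProbabilityMeasure Ξ => φ (risk h (p : Measure Ξ) θ)) q := by
    have h1 : Integrable (fun p : ProbabilityMeasure Ξ =>
        φ (risk h (p : Measure Ξ) θ) - risk h (p : Measure Ξ) θ) q :=
      Integrable.of_bound (hφm.sub hrm).aestronglyMeasurable ε (ae_of_all _ hbd)
    exact (h1.add hri).congr (ae_of_all _ fun p => by simp)
  rw [criterion, ← integral_sub hφi hri]
  simpa using norm_integral_le_of_norm_le_const (μ := q)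
    (f := fun p : ProbabilityMeasure Ξ =>
      φ (risk h (p : Measure Ξ) θ) - risk h (p : Measure Ξ) θ) (ae_of_all _ hbd)

end Criterion

/-- Approximate minimization: a criterion uniformly close to a risk has nearly optimal minimizers. -/
theorem abs_sub_le_of_isMinOn {Θ : Type*} {R V : Θ → ℝ} {δ : ℝ} (hδ : ∀ θ, |V θ - R θ| ≤ δ)
    {θ₀ θ₁ : Θ} (h₀ : IsMinOn R Set.univ θ₀) (h₁ : IsMinOn V Set.univ θ₁) :
    |R θ₁ - R θ₀| ≤ 2 * δ ∧ |V θ₁ - R θ₀| ≤ δ := by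
  have h2 : R θ₀ ≤ R θ₁ := h₀ (Set.mem_univ _)
  have h3 : V θ₁ ≤ V θ₀ := h₁ (Set.mem_univ _)
  have h4 := abs_le.1 (hδ θ₀)
  have h5 := abs_le.1 (hδ θ₁)
  constructor <;> rw [abs_le] <;> constructor <;> linarith

/-- A real supremum controls its terms only when the range is bounded; here the endpoint values
bound it. -/
theorem bddAbove_abs_sub_id {φ : ℝ → ℝ} {K : ℝ} (hφ : MonotoneOn φ (Set.Icc 0 K)) :
    BddAbove (Set.range fun t : Set.Icc (0 : ℝ) K => |φ t - t|) := by
  refine ⟨|φ 0| + |φ K| + K, ?_⟩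
  rintro _ ⟨⟨t, ht⟩, rfl⟩
  have hK : (0 : ℝ) ≤ K := ht.1.trans ht.2
  have h1 := hφ ⟨le_rfl, hK⟩ ht ht.1
  have h2 := hφ ht ⟨hK, le_rfl⟩ ht.2
  simp only
  rw [abs_le]
  constructor <;>
    linarith [neg_abs_le (φ 0), le_abs_self (φ K), abs_nonneg (φ 0), abs_nonneg (φ K), ht.1, ht.2]

end HDPRobust

end

/-! ### The convergence theorem. -/

theorem mainTheorem1
    -- the data space, the parameter set, the bounded loss
    {Ξ : Type*} [TopologicalSpace Ξ] [PolishSpace Ξ] [MeasurableSpace Ξ] [BorelSpace Ξ]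
    {Θ : Type*} (h : Θ → Ξ → ℝ) (hmeas : ∀ θ, Measurable (h θ))
    (K : ℝ) (hK : ∀ θ x, h θ x ∈ Set.Icc 0 K)
    -- the hierarchical Dirichlet process prior
    {S : ℕ} (α₀ : ℝ) (hα₀ : 0 < α₀) (α : Fin S → ℝ) (hα : ∀ s, 0 < α s)
    (H : Measure Ξ) [IsProbabilityMeasure H] [NullSingletonClass H]
    (prior : Measure (Fin S → ProbabilityMeasure Ξ))
    (hprior : HDPRobust.IsHDP α₀ α H prior)
    -- the data: independent observations, those of group `s` with diffuse law `pstar s`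
    {Ω : Type*} [MeasurableSpace Ω] (μ : Measure Ω) [IsProbabilityMeasure μ]
    (pstar : Fin S → Measure Ξ) [∀ s, IsProbabilityMeasure (pstar s)] [∀ s, NullSingletonClass (pstar s)]
    (ξ : Fin S → ℕ → Ω → Ξ)
    (hlaw : ∀ s j, HasLaw (ξ s j) (pstar s) μ)
    (hindep : iIndepFun (fun i : Fin S × ℕ => ξ i.1 i.2) μ)
    -- the posterior of `p_s` given the sample, for all group sizes
    (Q : (N : Fin S → ℕ+) → Fin S →
      Kernel (HDPRobust.Sample Ξ N) (ProbabilityMeasure Ξ))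
    (hQ : ∀ N s, HDPRobust.IsPosterior prior N s (Q N s))
    -- either the model determines the posterior at the data almost surely, or the version is
    -- the explicit one at tie-free samples
    (hversion : ∀ N : Fin S → ℕ+,
      (μ.map (fun ω (s : Fin S) (j : Fin (N s : ℕ)) => ξ s j ω) ≪
        HDPRobust.marginalLaw prior N) ∨
      (∀ (s : Fin S) (x : HDPRobust.Sample Ξ N), HDPRobust.TieFree x →
        HDPRobust.IsTwoStageLaw α₀ α H s x (Q N s x)))
    -- the transformations `φ n`, `n ≥ 1`
    (φ : ℕ → ℝ → ℝ)
    (hmono : ∀ n ≥ 1, StrictMonoOn (φ n) (Set.Icc 0 K))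
    (hconv : ∀ n ≥ 1, ConvexOn ℝ (Set.Icc 0 K) (φ n))
    (hsmooth : ∀ n ≥ 1, ContDiffOn ℝ 2 (φ n) (Set.Ioo 0 K))
    (hcurv : Tendsto (fun n => HDPRobust.curvatureSup K (φ n)) atTop (𝓝 0))
    (hslope : (⨆ n ≥ 1, HDPRobust.slopeSup K (φ n)) < ⊤)
    (hid : Tendsto (fun n => ⨆ t : Set.Icc (0 : ℝ) K, |φ n t - t|) atTop (𝓝 0))
    -- uniform convergence of the empirical risk of each group
    (hulln : ∀ s, ∀ᵐ ω ∂μ, Tendsto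
      (fun n : ℕ => ⨆ θ, |HDPRobust.risk h (HDPRobust.empirical fun j : Fin n => ξ s j ω) θ
        - HDPRobust.risk h (pstar s) θ|) atTop (𝓝 0))
    -- minimizers of the true risk and of the criterion
    (θstar : Fin S → Θ)
    (hθstar : ∀ s, IsMinOn (HDPRobust.risk h (pstar s)) Set.univ (θstar s))
    (θhat : (Fin S → ℕ+) → Fin S → Ω → Θ)
    (hθhat : ∀ᵐ ω ∂μ, ∀ N s, IsMinOn
      (HDPRobust.criterion h (φ (N s)) (Q N s fun l j => ξ l j ω)) Set.univ (θhat N s ω)) :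
    ∀ᵐ ω ∂μ, ∀ s,
      -- `N s → ∞`, with no restriction on the sizes of the other groups
      Tendsto (fun N : Fin S → ℕ+ => HDPRobust.risk h (pstar s) (θhat N s ω))
        (comap (fun N => N s) atTop) (𝓝 (HDPRobust.risk h (pstar s) (θstar s))) ∧
      Tendsto (fun N : Fin S → ℕ+ =>
          HDPRobust.criterion h (φ (N s)) (Q N s fun l j => ξ l j ω) (θhat N s ω))
        (comap (fun N => N s) atTop) (𝓝 (HDPRobust.risk h (pstar s) (θstar s))) := by
  obtain ⟨Λ, D, hDm, hΛ, hD, rfl⟩ := hprior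
  have hΛ1 : IsProbabilityMeasure Λ := hΛ.isProbabilityMeasure hα₀
  have htie : ∀ᵐ ω ∂μ, ∀ i i' : Fin S × ℕ, i ≠ i' → ξ i.1 i.2 ω ≠ ξ i'.1 i'.2 ω := by
    refine ae_all_iff.2 fun i => ae_all_iff.2 fun i' => ?_
    by_cases hi : i = i'
    · exact ae_of_all _ fun ω h => (h hi).elim
    · filter_upwards [HDPRobust.ae_ne_of_indepFun (hlaw i.1 i.2) (hlaw i'.1 i'.2)
        (hindep.indepFun hi)] with ω hω _ using hω
  -- There are countably many size vectors `N`, so one null set serves all of them.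
  have hdom : ∀ᵐ ω ∂μ, ∀ (N : Fin S → ℕ+) (s : Fin S),
      ∑ j : Fin (N s : ℕ), Measure.dirac (ξ s j ω) ≤ ENNReal.ofReal (α s + (N s : ℕ)) •
        (HDPRobust.evalKernel Ξ ∘ₘ Q N s fun l j => ξ l j ω) := by
    refine ae_all_iff.2 fun N => ae_all_iff.2 fun s => ?_
    rcases hversion N with hac | hex
    · have : Nonempty Ξ := by
        by_contra hne
        rw [not_nonempty_iff] at hne
        exact IsProbabilityMeasure.ne_zero H (Measure.eq_zero_of_isEmpty H)
      have hX : AEMeasurable (fun ω (s : Fin S) (j : Fin (N s : ℕ)) => ξ s j ω) μ :=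
        aemeasurable_pi_lambda _ fun l => aemeasurable_pi_lambda _ fun j => (hlaw l j).aemeasurable
      exact ae_of_ae_map hX (hac.ae_le (HDPRobust.sum_dirac_le_posterior_mean hα hD (hQ N s)))
    · filter_upwards [htie] with ω hω
      have hfree : HDPRobust.TieFree (N := N) fun l j => ξ l j ω := by
        rintro ⟨l, j⟩ ⟨l', j'⟩ hjj
        by_contra hne
        refine hω (l, j) (l', j') (fun h => hne ?_) hjj
        obtain ⟨rfl, hj⟩ := Prod.mk.inj h
        rw [Fin.ext hj]
      have hle := HDPRobust.IsTwoStageLaw.sum_dirac_le hα₀ (hα s) (hex s _ hfree)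
      exact hle
  filter_upwards [hdom, ae_all_iff.2 hulln, hθhat] with ω hω hu hmin s
  have hpos (n : ℕ) : 0 < α s + n := add_pos_of_pos_of_nonneg (hα s) n.cast_nonneg
  -- the uniform error of the criterion as a function of the size of group `s`
  set δ : ℕ → ℝ := fun n => (⨆ t : Set.Icc (0 : ℝ) K, |φ n t - t|) + α s * K / (α s + n) +
    ⨆ θ, |HDPRobust.risk h (HDPRobust.empirical fun j : Fin n => ξ s j ω) θ
      - HDPRobust.risk h (pstar s) θ| with hδ
  have hδ0 : Tendsto δ atTop (𝓝 0) := by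
    have h1 : Tendsto (fun n : ℕ => α s * K / (α s + n)) atTop (𝓝 0) :=
      tendsto_const_nhds.div_atTop (tendsto_atTop_add_const_left _ _ tendsto_natCast_atTop_atTop)
    simpa using (hid.add h1).add (hu s)
  -- `δ` is evaluated at `N s` alone, so convergence along the `comap` filter leaves the other sizes
  -- free.
  have hN0 : Tendsto (fun N : Fin S → ℕ+ => δ (N s)) (comap (fun N => N s) atTop) (𝓝 0) :=
    hδ0.comp (tendsto_PNat_val_atTop_atTop.comp tendsto_comap)
  have hbound (N : Fin S → ℕ+) (θ : Θ) :
      |HDPRobust.criterion h (φ (N s)) (Q N s fun l j => ξ l j ω) θ -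
        HDPRobust.risk h (pstar s) θ| ≤ δ (N s) := by
    have hn : 1 ≤ (N s : ℕ) := (N s).pos
    have := (hQ N s).1
    have : Nonempty (Fin (N s : ℕ)) := ⟨⟨0, hn⟩⟩
    have hemp : IsProbabilityMeasure (HDPRobust.empirical fun j : Fin (N s : ℕ) => ξ s j ω) :=
      ⟨HDPRobust.empirical_apply_univ _⟩
    have hmo := (hmono _ hn).monotoneOn
    have b1 := HDPRobust.abs_criterion_sub_le hmeas hK (q := Q N s fun l j => ξ l j ω) hmo
      (fun t ht => le_ciSup (HDPRobust.bddAbove_abs_sub_id hmo) ⟨t, ht⟩) θ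
    have b2 := HDPRobust.abs_integral_risk_sub_le hmeas hK (hα s) hn (hω N s) θ
    have hbdd : BddAbove (Set.range fun θ =>
        |HDPRobust.risk h (HDPRobust.empirical fun j : Fin (N s : ℕ) => ξ s j ω) θ
          - HDPRobust.risk h (pstar s) θ|) := by
      refine ⟨K, ?_⟩
      rintro _ ⟨θ, rfl⟩
      have r1 := HDPRobust.risk_mem_Icc hmeas hK θ
        (HDPRobust.empirical fun j : Fin (N s : ℕ) => ξ s j ω)
      have r2 := HDPRobust.risk_mem_Icc hmeas hK θ (pstar s)
      exact abs_le.2 ⟨by linarith [r1.1, r2.2], by linarith [r1.2, r2.1]⟩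
    have b3 := le_ciSup hbdd θ
    -- Triangle inequality through the posterior expected risk and then the empirical risk.
    refine (abs_sub_le _ (∫ p, HDPRobust.risk h ((p : ProbabilityMeasure Ξ) : Measure Ξ) θ ∂(Q N s fun l j => ξ l j ω)) _).trans ?_
    refine (add_le_add b1 ((abs_sub_le _ _ _).trans (add_le_add b2 b3))).trans ?_
    rw [hδ, ← add_assoc]
  have hfin (N : Fin S → ℕ+) := HDPRobust.abs_sub_le_of_isMinOn (hbound N) (hθstar s) (hmin N s)
  refine ⟨tendsto_iff_norm_sub_tendsto_zero.2 ?_, tendsto_iff_norm_sub_tendsto_zero.2 ?_⟩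
  · exact squeeze_zero (fun _ => norm_nonneg _) (fun N => (hfin N).1) (by simpa using hN0.const_mul 2)
  · exact squeeze_zero (fun _ => norm_nonneg _) (fun N => (hfin N).2) hN0
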